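/- Let $k\ge 4$ be even and $\ell=k/2$. Consider the non-crossing perfect matchings of $2k$ points in convex position, labelled clockwise by the residues modulo $2k$. Let $\mathbf{DCM}_k$ be the graph whose vertices are these matchings, two of them being adjacent when they are disjoint compatible, that is, when they have no common edge and no edge of one crosses an edge of the other. A strip drawing of a matching places the points on the upper and the lower side of a rectangle (clockwise order: upper side from left to right, then lower side from right to left). A D-edge is a vertical edge that joins the two sides, a B-edge joins two neighbouring points of one side; its position is $+$ on the upper and $-$ on the lower side. For a sequence of signs $p=(p_1,\dots,p_{\ell-1})$, for $1\le j\le \ell-1$ and for $z\in\mathbb Z/2k$, let $\mathrm{EDB}(k,j,p,z)$ be the matching of size $k$ with the following strip drawing, in which $z$ is the label of the leftmost point of the upper side. From left to right there are $\ell-1$ elements; for $i\neq j$ the $i$-th one is a D-edge followed by a B-edge of position $p_i$; the $j$-th one is a D-edge followed by three B-edges, two on the side $p_j$ and one on the opposite side. These are the EDB-matchings of size $k$. Let $p'$ be obtained from $p$ by reversing the sequence and changing all the signs, let $\delta(p)$ be the number of $+$ minus the number of $-$ in $p$, and let $z'=z+k+\delta(p)$. Then the connected component of $\mathbf{DCM}_k$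 that contains $\mathrm{EDB}(k,j,p,z)$ has the following structure. 1. It contains a path $P=M_1M_2\cdots M_{k-2}$ on $k-2$ pairwise distinct vertices, where $M_{2i-1}=\mathrm{EDB}(k,i,p,z)$ and $M_{2i}=\mathrm{EDB}(k,\ell-i,p',z')$ for $1\le i\le \ell-1$. 2. Besides the edges of the path, the edges between vertices of $P$ are exactly the edges $M_aM_b$ with $a$ even, $b$ odd and $a\le b-3$. Equivalently, $\mathrm{EDB}(k,j_1,p,z)$ and $\mathrm{EDB}(k,j_2,p',z')$ are adjacent precisely when $j_1+j_2\in\{\ell,\ell+1\}$ (the edges of the path) or $j_1+j_2\ge \ell+2$ (the additional edges). 3. Each vertex of $P$ has exactly two neighbours outside $P$, and each of these is a leaf, that is, has no other neighbour in $\mathbf{DCM}_k$. The component consists of the vertices of $P$ and of these leaves. In particular, for fixed $k$ all the components that contain EDB-matchings are isomorphic, and their order is $3(k-2)$. -/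

import Mathlib

/-! Non-crossing perfect matchings of `2k` points in convex position, their disjoint compatibility
graph, strip drawings, and EDB-matchings. -/

namespace DisjointCompatible

/-- The points in convex position are the elements of `ZMod n`, in cyclic (clockwise) order.
The pairs `{a, b}` and `{c, d}` cross if exactly one of `c`, `d` lies strictly between `a` and `b`,
and the other one strictly between `b` and `a`; that is, if they alternate in the cyclic order. -/
def Crossing {n : ℕ} (a b c d : ZMod n) : Prop :=
  (sbtw a c b ∧ sbtw b d a) ∨ (sbtw a d b ∧ sbtw b c a)

/-- A non-crossing (perfect) matching of size `k`, for `k ≥ 1`: a partition of the `2k` cyclically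
ordered points into pairwise non-crossing pairs `{x, partner x}`. -/
@[ext]
structure NCMatching (k : ℕ) where
  partner : ZMod (2 * k) → ZMod (2 * k)
  partner_partner : ∀ x, partner (partner x) = x
  partner_ne : ∀ x, partner x ≠ x
  not_crossing : ∀ x y, ¬ Crossing x (partner x) y (partner y)

/-- Two matchings are disjoint compatible if they have no common edge and no edge of the first
crosses an edge of the second. -/
def DisjCompat {k : ℕ} (M N : NCMatching k) : Prop :=
  (∀ x, M.partner x ≠ N.partner x) ∧
    ∀ x y, ¬ Crossing x (M.partner x) y (N.partner y)

lemma sbtw_four {α : Type*} [CircularOrder α] {a b c d : α} (h1 : sbtw a b c)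
    (h2 : sbtw c d a) : sbtw b c d ∧ sbtw d a b :=
  ⟨(h2.cyclic_left.trans_left h1).cyclic_left, (h1.cyclic_left.trans_left h2).cyclic_left⟩

lemma DisjCompat.symm {k : ℕ} {M N : NCMatching k} (h : DisjCompat M N) : DisjCompat N M := by
  refine ⟨fun x hx => h.1 x hx.symm, fun x y hc => h.2 y x ?_⟩
  rcases hc with ⟨h1, h2⟩ | ⟨h1, h2⟩
  · exact Or.inr (sbtw_four h1 h2)
  · exact Or.inl (sbtw_four h1 h2).symm

/-- The disjoint compatibility graph of matchings of size `k`.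
(For `k ≥ 1` disjoint compatible matchings are automatically distinct.) -/
def DCM (k : ℕ) : SimpleGraph (NCMatching k) where
  Adj M N := M ≠ N ∧ DisjCompat M N
  symm := ⟨fun _ _ h => ⟨h.1.symm, h.2.symm⟩⟩
  loopless := ⟨fun _ h => h.1 rfl⟩

/-! ### Strip drawings -/

/-- The edges of a strip drawing: a vertical D-edge joining the upper side to the lower side, and
a B-edge joining two neighbouring points of one side (`true`, i.e. `+`, is the upper side and
`false`, i.e. `-`, is the lower side). -/
inductive StripEdge where
  | D : StripEdge
  | B (pos : Bool) : StripEdge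

/-- The matching drawn by a strip drawing, read as a list of edges from left to right.
A point is given by its clockwise offset from the leftmost point of the upper side: first come the
points of the upper side from left to right, then those of the lower side from right to left.
So a leftmost D-edge joins the first and the last point, a leftmost upper B-edge joins the first
two points, and a leftmost lower B-edge joins the last two points. -/
def stripPartner : List StripEdge → ℕ → ℕ
  | [], x => x
  | .D :: w, x =>
      if x = 0 then 2 * w.length + 1
      else if x = 2 * w.length + 1 then 0
      else stripPartner w (x - 1) + 1
  | .B true :: w, x =>
      if x = 0 then 1
      else if x = 1 then 0
      else stripPartner w (x - 2) + 2
  | .B false :: w, x =>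
      if x = 2 * w.length then 2 * w.length + 1
      else if x = 2 * w.length + 1 then 2 * w.length
      else stripPartner w x

lemma stripPartner_lt (w : List StripEdge) :
    ∀ x, x < 2 * w.length → stripPartner w x < 2 * w.length := by
  induction w with
  | nil => simp
  | cons e w ih =>
    intro x hx
    simp only [List.length_cons] at hx ⊢
    match e with
    | .D =>
      simp only [stripPartner]
      split_ifs
      · omega
      · omega
      · have := ih (x - 1) (by omega); omega
    | .B true =>
      simp only [stripPartner]
      split_ifs
      · omega
      · omega
      · have := ih (x - 2) (by omega); omega
    | .B false =>
      simp only [stripPartner]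
      split_ifs
      · omega
      · omega
      · have := ih x (by omega); omega

lemma stripPartner_stripPartner (w : List StripEdge) :
    ∀ x, x < 2 * w.length → stripPartner w (stripPartner w x) = x := by
  induction w with
  | nil => simp
  | cons e w ih =>
    intro x hx
    simp only [List.length_cons] at hx
    match e with
    | .D =>
      simp only [stripPartner]
      by_cases h0 : x = 0
      · simp [h0]
      by_cases h1 : x = 2 * w.length + 1
      · simp [h1]
      have h2 := ih (x - 1) (by omega)
      have h3 := stripPartner_lt w (x - 1) (by omega)
      have h4 : ¬ stripPartner w (x - 1) = 2 * w.length := by omega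
      simp [h0, h1, h2, h4]
      omega
    | .B true =>
      simp only [stripPartner]
      by_cases h0 : x = 0
      · simp [h0]
      by_cases h1 : x = 1
      · simp [h1]
      have h2 := ih (x - 2) (by omega)
      simp [h0, h1, h2]
      omega
    | .B false =>
      simp only [stripPartner]
      by_cases h0 : x = 2 * w.length
      · simp [h0]
      by_cases h1 : x = 2 * w.length + 1
      · simp [h1]
      have h2 := ih x (by omega)
      have h3 := stripPartner_lt w x (by omega)
      have h4 : ¬ stripPartner w x = 2 * w.length := by omega
      have h5 : ¬ stripPartner w x = 2 * w.length + 1 := by omega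
      simp [h0, h1, h2, h4, h5]

lemma stripPartner_ne (w : List StripEdge) :
    ∀ x, x < 2 * w.length → stripPartner w x ≠ x := by
  induction w with
  | nil => simp
  | cons e w ih =>
    intro x hx
    simp only [List.length_cons] at hx
    match e with
    | .D =>
      simp only [stripPartner]
      split_ifs
      · omega
      · omega
      · have := ih (x - 1) (by omega); omega
    | .B true =>
      simp only [stripPartner]
      split_ifs
      · omega
      · omega
      · have := ih (x - 2) (by omega); omega
    | .B false =>
      simp only [stripPartner]
      split_ifs
      · omega
      · omega
      · have := ih x (by omega); omega

lemma stripPartner_nc (w : List StripEdge) :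
    ∀ x y, x < 2 * w.length → y < 2 * w.length →
      ¬ (x < y ∧ y < stripPartner w x ∧ stripPartner w x < stripPartner w y) := by
  induction w with
  | nil => simp
  | cons e w ih =>
    intro x y hx hy
    simp only [List.length_cons] at hx hy
    have hlt := stripPartner_lt w
    match e with
    | .D =>
      simp only [stripPartner]
      split_ifs <;> try omega
      · have := hlt (y - 1) (by omega); omega
      · have := ih (x - 1) (y - 1) (by omega) (by omega); omega
    | .B true =>
      simp only [stripPartner]
      split_ifs <;> try omega
      · have := ih (x - 2) (y - 2) (by omega) (by omega); omega
    | .B false =>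
      simp only [stripPartner]
      split_ifs <;> try omega
      all_goals
        have h1 := hlt x
        have h2 := hlt y
        have h3 := ih x y
        omega

lemma zmod_sbtw_iff {n : ℕ} [NeZero n] (a b c : ZMod n) :
    sbtw a b c ↔ a.val < b.val ∧ b.val < c.val ∨ b.val < c.val ∧ c.val < a.val ∨
      c.val < a.val ∧ a.val < b.val := by
  cases n with
  | zero => exact absurd rfl (NeZero.ne 0)
  | succ n => exact Iff.rfl

lemma zmod_val_add {n : ℕ} [NeZero n] (a b : ZMod n) :
    (a + b).val = if a.val + b.val < n then a.val + b.val else a.val + b.val - n := by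
  have ha := a.val_lt
  have hb := b.val_lt
  split_ifs with h
  · exact ZMod.val_add_of_lt h
  · exact ZMod.val_add_of_le (by omega) |>.trans (by omega)

lemma zmod_sbtw_add {n : ℕ} [NeZero n] (z a b c : ZMod n) :
    sbtw (z + a) (z + b) (z + c) ↔ sbtw a b c := by
  have hz := z.val_lt
  have ha := a.val_lt
  have hb := b.val_lt
  have hc := c.val_lt
  simp only [zmod_sbtw_iff, zmod_val_add]
  split_ifs <;> omega

/-- The matching with strip drawing `w` of `k` edges in which `z` is the label of the leftmost
point of the upper side, the points being labelled clockwise. -/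
def stripMatching {k : ℕ} (hk : k ≠ 0) (w : List StripEdge) (hw : w.length = k)
    (z : ZMod (2 * k)) : NCMatching k where
  partner x := z + (stripPartner w (x - z).val : ℕ)
  partner_partner x := by
    have : NeZero (2 * k) := ⟨by omega⟩
    have h : (x - z).val < 2 * w.length := by rw [hw]; exact (x - z).val_lt
    have h' : stripPartner w (x - z).val < 2 * k := lt_of_lt_of_eq (stripPartner_lt w _ h) (by rw [hw])
    rw [add_sub_cancel_left, ZMod.val_natCast, Nat.mod_eq_of_lt h',
      stripPartner_stripPartner w _ h, ZMod.natCast_zmod_val]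
    abel
  partner_ne x hx := by
    have : NeZero (2 * k) := ⟨by omega⟩
    have h : (x - z).val < 2 * w.length := by rw [hw]; exact (x - z).val_lt
    have h' : stripPartner w (x - z).val < 2 * k := lt_of_lt_of_eq (stripPartner_lt w _ h) (by rw [hw])
    apply stripPartner_ne w (x - z).val h
    have h1 : ((stripPartner w (x - z).val : ℕ) : ZMod (2 * k)) = x - z :=
      eq_sub_of_add_eq' hx
    have h2 := congrArg ZMod.val h1
    rwa [ZMod.val_natCast, Nat.mod_eq_of_lt h'] at h2
  not_crossing x y hc := by
    have : NeZero (2 * k) := ⟨by omega⟩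
    obtain ⟨a, rfl⟩ : ∃ a, x = z + a := ⟨x - z, by abel⟩
    obtain ⟨b, rfl⟩ : ∃ b, y = z + b := ⟨y - z, by abel⟩
    simp only [Crossing, zmod_sbtw_add, add_sub_cancel_left] at hc
    have ha : a.val < 2 * w.length := by rw [hw]; exact a.val_lt
    have hb : b.val < 2 * w.length := by rw [hw]; exact b.val_lt
    have ha' := stripPartner_lt w _ ha
    have hb' := stripPartner_lt w _ hb
    have n1 := stripPartner_nc w _ _ ha hb
    have n2 := stripPartner_nc w _ _ ha hb'
    have n3 := stripPartner_nc w _ _ ha' hb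
    have n4 := stripPartner_nc w _ _ ha' hb'
    have m1 := stripPartner_nc w _ _ hb ha
    have m2 := stripPartner_nc w _ _ hb ha'
    have m3 := stripPartner_nc w _ _ hb' ha
    have m4 := stripPartner_nc w _ _ hb' ha'
    rw [stripPartner_stripPartner w _ ha] at n3 n4 m2 m4
    rw [stripPartner_stripPartner w _ hb] at n2 n4 m3 m4
    rw [hw] at ha' hb'
    simp only [zmod_sbtw_iff, ZMod.val_natCast, Nat.mod_eq_of_lt ha', Nat.mod_eq_of_lt hb'] at hc
    omega

/-! ### EDB-matchings of size `k = 2ℓ` -/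

/-- The `i`-th element of the standard strip drawing of an EDB-matching whose element number `j` is
the EDB-element. Each element is R-directed. A DB-element of position `s` is a D-edge followed by
a B-edge on the side `s`. An EDB-element of position `s` has moreover one B-edge on each side; so
it is a D-edge followed by two B-edges on the side `s` and one B-edge on the opposite side. -/
def edbElement {m : ℕ} (p : Fin m → Bool) (j i : Fin m) : List StripEdge :=
  if i = j then [.D, .B (p i), .B (p i), .B (!p i)] else [.D, .B (p i)]

/-- The standard strip drawing of an EDB-matching: the drawing of the DB-matching with positions
`p`, with its `j`-th DB-element replaced by the EDB-element of the same direction and position. -/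
def edbDrawing {m : ℕ} (p : Fin m → Bool) (j : Fin m) : List StripEdge :=
  (List.ofFn (edbElement p j)).flatten

lemma edbDrawing_length {l : ℕ} (p : Fin (l - 1) → Bool) (j : Fin (l - 1)) :
    (edbDrawing p j).length = 2 * l := by
  have h : ∀ i, (edbElement p j i).length = 2 + if i = j then 2 else 0 := by
    intro i
    unfold edbElement
    split_ifs <;> rfl
  have hj := j.isLt
  rw [edbDrawing, List.length_flatten, List.map_ofFn, List.sum_ofFn]
  simp only [Function.comp_apply, h, Finset.sum_add_distrib, Finset.sum_const, Finset.card_univ,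
    Fintype.card_fin, smul_eq_mul, Finset.sum_ite_eq', Finset.mem_univ, if_true]
  omega

/-- The EDB-matching of size `2l`. The index `j : Fin (l - 1)` stands for the element number
`j + 1` among the elements numbered `1, …, l - 1`; the function `p` gives the positions of the
elements from left to right, and `z` is the label of the leftmost point of the upper side. -/
def edb {l : ℕ} (j : Fin (l - 1)) (p : Fin (l - 1) → Bool) (z : ZMod (2 * (2 * l))) :
    NCMatching (2 * l) :=
  stripMatching (by have := j.isLt; omega) (edbDrawing p j) (edbDrawing_length p j) z

/-- The sequence `p'`: the sequence `p` reversed, with all the signs changed. -/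
def revNeg {m : ℕ} (p : Fin m → Bool) : Fin m → Bool := fun i => !p i.rev

/-- The number of `+` minus the number of `-` in the sequence `p`. -/
def signSum {m : ℕ} (p : Fin m → Bool) : ℤ := ∑ i, if p i then 1 else -1

/-- The label `z' = z + k + δ(p)`, where `k = 2l`. -/
def zPrime {l : ℕ} (p : Fin (l - 1) → Bool) (z : ZMod (2 * (2 * l))) : ZMod (2 * (2 * l)) :=
  z + (((2 * l : ℕ) : ℤ) + signSum p : ℤ)

/-- The vertices `M_1, M_2, …, M_{k-2}` of the path, `k = 2l`; the index `t` stands for the number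
`t + 1`. With elements numbered from `1`, `M_{2i-1} = EDB(k, i, p, z)` and
`M_{2i} = EDB(k, l - i, p', z')` for `1 ≤ i ≤ l - 1`. -/
def pathVertex {l : ℕ} (p : Fin (l - 1) → Bool) (z : ZMod (2 * (2 * l)))
    (t : Fin (2 * l - 2)) : NCMatching (2 * l) :=
  let i : Fin (l - 1) := ⟨t.val / 2, by have := t.isLt; omega⟩
  if t.val % 2 = 0 then edb i p z else edb i.rev (revNeg p) (zPrime p z)

end DisjointCompatible

namespace DisjointCompatible

/-! ### Words and drawings -/

/-- The pieces of a drawing: a D-edge, a B-edge of a given position, and a cap of a given position,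
that is, two nested edges on four consecutive points of one side. -/
inductive Piece where
  | D : Piece
  | B (pos : Bool) : Piece
  | C (pos : Bool) : Piece

namespace Piece

/-- The number of edges of a piece. -/
def size : Piece → ℕ
  | D => 1
  | B _ => 1
  | C _ => 2

/-- The number of points of a piece on the upper side. -/
def up : Piece → ℕ
  | D => 1
  | B s => if s then 2 else 0
  | C s => if s then 4 else 0

/-- The number of points of a piece on the lower side. -/
def low : Piece → ℕ
  | D => 1
  | B s => if s then 0 else 2
  | C s => if s then 0 else 4

/-- The half-turn of a piece. -/
def rot : Piece → Piece
  | D => D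
  | B s => B !s
  | C s => C !s

end Piece

open Piece

/-- The number of edges of a word. -/
def wsize : List Piece → ℕ
  | [] => 0
  | e :: w => e.size + wsize w

/-- The number of points of a word on the upper side. -/
def wup : List Piece → ℕ
  | [] => 0
  | e :: w => e.up + wup w

/-- The number of points of a word on the lower side. -/
def wlow : List Piece → ℕ
  | [] => 0
  | e :: w => e.low + wlow w

/-- `g` matches the points of a piece according to its drawing, `t` and `b` being the first points
on the upper and on the lower side. -/
def DrawnPiece {R : Type*} [CommRing R] (g : R → R) (t b : R) : Piece → Prop
  | .D => g t = b ∧ g b = t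
  | .B true => g t = t + 1 ∧ g (t + 1) = t
  | .B false => g b = b - 1 ∧ g (b - 1) = b
  | .C true => (g t = t + 3 ∧ g (t + 3) = t) ∧ g (t + 1) = t + 2 ∧ g (t + 2) = t + 1
  | .C false => (g b = b - 3 ∧ g (b - 3) = b) ∧ g (b - 1) = b - 2 ∧ g (b - 2) = b - 1

/-- `g` matches the points according to the drawing of a word from left to right, `t` and `b` being
the leftmost points on the upper and on the lower side. -/
def Drawn {R : Type*} [CommRing R] (g : R → R) : List Piece → R → R → Prop
  | [], _, _ => True
  | e :: w, t, b => DrawnPiece g t b e ∧ Drawn g w (t + e.up) (b - e.low)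

lemma wsize_append (u v : List Piece) : wsize (u ++ v) = wsize u + wsize v := by
  induction u with
  | nil => simp [wsize]
  | cons e u ih => simp [wsize, ih, add_assoc]

lemma wup_append (u v : List Piece) : wup (u ++ v) = wup u + wup v := by
  induction u with
  | nil => simp [wup]
  | cons e u ih => simp [wup, ih, add_assoc]

lemma wlow_append (u v : List Piece) : wlow (u ++ v) = wlow u + wlow v := by
  induction u with
  | nil => simp [wlow]
  | cons e u ih => simp [wlow, ih, add_assoc]

lemma Piece.up_add_low (e : Piece) : e.up + e.low = 2 * e.size := by
  rcases e with _ | s | s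
  · rfl
  all_goals cases s <;> rfl

lemma wup_add_wlow (w : List Piece) : wup w + wlow w = 2 * wsize w := by
  induction w with
  | nil => rfl
  | cons e w ih => have := e.up_add_low; simp only [wup, wlow, wsize]; omega

/-- Removing the left part of a strip removes points at both ends of the interval of offsets, so
what lies to the right of a cut is again an interval. All later inductions run along these nested
intervals. -/
lemma drawn_append {R : Type*} [CommRing R] (g : R → R) (u v : List Piece) (t b : R) :
    Drawn g (u ++ v) t b ↔ Drawn g u t b ∧ Drawn g v (t + wup u) (b - wlow u) := by
  induction u generalizing t b with
  | nil => simp [Drawn, wup, wlow]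
  | cons e u ih =>
    simp only [List.cons_append, Drawn, ih, wup, wlow, Nat.cast_add, add_assoc, and_assoc,
      sub_sub]

/-- The half-turn of a word. -/
def wrot : List Piece → List Piece
  | [] => []
  | e :: w => wrot w ++ [e.rot]

lemma wrot_append (u v : List Piece) : wrot (u ++ v) = wrot v ++ wrot u := by
  induction u with
  | nil => simp [wrot]
  | cons e u ih => simp [wrot, ih]

lemma wup_wrot (w : List Piece) : wup (wrot w) = wlow w := by
  induction w with
  | nil => rfl
  | cons e w ih =>
    rcases e with _ | s | s
    · simp [wrot, wup_append, ih, wup, wlow, up, low, Piece.rot, add_comm]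
    all_goals cases s <;> simp [wrot, wup_append, ih, wup, wlow, up, low, Piece.rot, add_comm]

lemma wlow_wrot (w : List Piece) : wlow (wrot w) = wup w := by
  induction w with
  | nil => rfl
  | cons e w ih =>
    rcases e with _ | s | s
    · simp [wrot, wlow_append, ih, wup, wlow, up, low, Piece.rot, add_comm]
    all_goals cases s <;> simp [wrot, wlow_append, ih, wup, wlow, up, low, Piece.rot, add_comm]

/-- Lower labels decrease from left to right, so `b - e.low + 1` is the rightmost lower point of the
piece (if it has lower points), which the half-turn makes its first upper point. -/
lemma DrawnPiece.rot {R : Type*} [CommRing R] {g : R → R} {t b : R} {e : Piece}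
    (h : DrawnPiece g t b e) :
    DrawnPiece g (b - e.low + 1) (t + e.up - 1) e.rot := by
  have e1 : t + 1 + 1 - 1 = t + 1 := by ring
  have e2 : t + 2 - 1 = t + 1 := by ring
  have e3 : b - 2 + 1 = b - 1 := by ring
  have e4 : t + 4 - 1 = t + 3 := by ring
  have e5 : b - 4 + 1 = b - 3 := by ring
  have e6 : t + 3 - 1 = t + 2 := by ring
  have e7 : t + 3 - 2 = t + 1 := by ring
  have e8 : t + 3 - 3 = t := by ring
  have e9 : b - 3 + 1 = b - 2 := by ring
  have e10 : b - 3 + 2 = b - 1 := by ring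
  have e11 : b - 3 + 3 = b := by ring
  have e12 : t + 1 - 1 = t := by ring
  have e13 : b - 1 + 1 = b := by ring
  rcases e with _ | s | s
  · simpa [DrawnPiece, up, low, Piece.rot] using h.symm
  · cases s <;> simp_all [DrawnPiece, up, low, Piece.rot]
  · cases s <;> simp_all [DrawnPiece, up, low, Piece.rot]

lemma Drawn.rot {R : Type*} [CommRing R] {g : R → R} {w : List Piece} {t b : R}
    (h : Drawn g w t b) : Drawn g (wrot w) (b - wlow w + 1) (t + wup w - 1) := by
  induction w generalizing t b with
  | nil => trivial
  | cons e w ih =>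
    obtain ⟨h1, h2⟩ := h
    rw [wrot, drawn_append]
    have h3 := ih h2
    have h4 := h1.rot
    refine ⟨?_, ?_, trivial⟩
    · convert h3 using 1 <;> (simp only [wup, wlow]; push_cast; ring)
    · rw [wup_wrot, wlow_wrot]
      convert h4 using 1 <;> (simp only [wup, wlow]; push_cast; ring)

/-! ### Matchings as functions on the integers -/

/-- `g` maps the interval `[a, b]` to itself. -/
def Pres (g : ℤ → ℤ) (a b : ℤ) : Prop := ∀ x, a ≤ x → x ≤ b → a ≤ g x ∧ g x ≤ b

lemma Drawn.pres {g : ℤ → ℤ} {w : List Piece} {a b : ℤ} (h : Drawn g w a b)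
    (hb : b = a + 2 * wsize w - 1) : Pres g a b := by
  induction w generalizing a b with
  | nil => intro x; simp only [wsize] at hb; omega
  | cons e w ih =>
    obtain ⟨h1, h2⟩ := h
    have h3 := ih h2 (by have := e.up_add_low; simp only [wsize] at hb; push_cast at hb; omega)
    intro x hx hx'
    have h4 := h3 x
    simp only [wsize] at hb
    rcases e with _ | s | s
    · simp only [DrawnPiece, up, low, size] at *
      push_cast at *
      by_cases hc : x = a
      · subst hc; omega
      by_cases hc : x = b
      · subst hc; omega
      omega
    · cases s <;> simp [DrawnPiece, up, low, size] at *
      · by_cases hc : x = b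
        · subst hc; omega
        by_cases hc : x = b - 1
        · subst hc; omega
        omega
      · by_cases hc : x = a
        · subst hc; omega
        by_cases hc : x = a + 1
        · subst hc; omega
        omega
    · cases s <;> simp [DrawnPiece, up, low, size] at *
      · by_cases hc : x = b
        · subst hc; omega
        by_cases hc : x = b - 1
        · subst hc; omega
        by_cases hc : x = b - 2
        · subst hc; omega
        by_cases hc : x = b - 3
        · subst hc; omega
        omega
      · by_cases hc : x = a
        · subst hc; omega
        by_cases hc : x = a + 1
        · subst hc; omega
        by_cases hc : x = a + 2
        · subst hc; omega
        by_cases hc : x = a + 3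
        · subst hc; omega
        omega

lemma Drawn.unique {f g : ℤ → ℤ} {w : List Piece} {a b : ℤ} (hf : Drawn f w a b)
    (hg : Drawn g w a b) (hb : b = a + 2 * wsize w - 1) (x : ℤ) (hx : a ≤ x) (hx' : x ≤ b) :
    f x = g x := by
  induction w generalizing a b with
  | nil => simp only [wsize] at hb; omega
  | cons e w ih =>
    obtain ⟨h1, h2⟩ := hf
    obtain ⟨k1, k2⟩ := hg
    have h4 := ih h2 k2 (by have := e.up_add_low; simp only [wsize] at hb; push_cast at hb; omega)
    simp only [wsize] at hb
    rcases e with _ | s | s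
    · simp only [DrawnPiece, up, low, size] at *
      push_cast at *
      by_cases hc : x = a
      · subst hc; omega
      by_cases hc : x = b
      · subst hc; omega
      omega
    · cases s <;> simp [DrawnPiece, up, low, size] at *
      · by_cases hc : x = b
        · subst hc; omega
        by_cases hc : x = b - 1
        · subst hc; omega
        omega
      · by_cases hc : x = a
        · subst hc; omega
        by_cases hc : x = a + 1
        · subst hc; omega
        omega
    · cases s <;> simp [DrawnPiece, up, low, size] at *
      · by_cases hc : x = b
        · subst hc; omega
        by_cases hc : x = b - 1
        · subst hc; omega
        by_cases hc : x = b - 2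
        · subst hc; omega
        by_cases hc : x = b - 3
        · subst hc; omega
        omega
      · by_cases hc : x = a
        · subst hc; omega
        by_cases hc : x = a + 1
        · subst hc; omega
        by_cases hc : x = a + 2
        · subst hc; omega
        by_cases hc : x = a + 3
        · subst hc; omega
        omega

/-- The offsets of the partners in a matching, with respect to the point `z`; outside the interval
`[0, 2k - 1]` the integers are matched by nested pairs around this interval. -/
def off {k : ℕ} (N : NCMatching k) (z : ZMod (2 * k)) (x : ℤ) : ℤ :=
  if 0 ≤ x ∧ x < 2 * k then ((N.partner (z + x) - z).val : ℤ) else 2 * k - 1 - x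

lemma val_intCast_of_lt {k : ℕ} (x : ℤ) (h0 : 0 ≤ x) (h1 : x < 2 * k) :
    (((x : ZMod (2 * k)).val : ℕ) : ℤ) = x := by
  have : NeZero (2 * k) := ⟨by omega⟩
  rw [ZMod.val_intCast]
  exact Int.emod_eq_of_lt h0 (by push_cast; exact h1)

lemma exists_offset {k : ℕ} (hk : k ≠ 0) (z y : ZMod (2 * k)) :
    ∃ x : ℤ, 0 ≤ x ∧ x < 2 * k ∧ y = z + x := by
  have : NeZero (2 * k) := ⟨by omega⟩
  refine ⟨((y - z).val : ℤ), by positivity, by exact_mod_cast (y - z).val_lt, ?_⟩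
  simp

lemma off_eq_iff {k : ℕ} (N : NCMatching k) (z : ZMod (2 * k)) {x y : ℤ} (hx : 0 ≤ x)
    (hx' : x < 2 * k) (hy : 0 ≤ y) (hy' : y < 2 * k) :
    off N z x = y ↔ N.partner (z + x) = z + y := by
  have : NeZero (2 * k) := ⟨by omega⟩
  rw [off, if_pos ⟨hx, hx'⟩]
  constructor
  · intro h
    have h1 : N.partner (z + x) - z = (y : ZMod (2 * k)) := by
      rw [← h]; simp
    rw [← h1]; ring
  · intro h
    rw [h, add_sub_cancel_left]
    exact val_intCast_of_lt y hy hy'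

lemma off_mem {k : ℕ} (N : NCMatching k) (z : ZMod (2 * k)) {x : ℤ} (hx : 0 ≤ x)
    (hx' : x < 2 * k) : 0 ≤ off N z x ∧ off N z x < 2 * k := by
  have : NeZero (2 * k) := ⟨by omega⟩
  rw [off, if_pos ⟨hx, hx'⟩]
  have := (N.partner (z + x) - z).val_lt
  omega

lemma off_outside {k : ℕ} (N : NCMatching k) (z : ZMod (2 * k)) {x : ℤ}
    (hx : ¬ (0 ≤ x ∧ x < 2 * k)) : off N z x = 2 * k - 1 - x := if_neg hx

lemma partner_add {k : ℕ} (N : NCMatching k) (z : ZMod (2 * k)) {x : ℤ} (hx : 0 ≤ x)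
    (hx' : x < 2 * k) : N.partner (z + x) = z + (off N z x : ℤ) :=
  (off_eq_iff N z hx hx' (off_mem N z hx hx').1 (off_mem N z hx hx').2).1 rfl

lemma off_off {k : ℕ} (N : NCMatching k) (z : ZMod (2 * k)) (x : ℤ) :
    off N z (off N z x) = x := by
  by_cases h : 0 ≤ x ∧ x < 2 * k
  · have h1 := off_mem N z h.1 h.2
    rw [off_eq_iff N z h1.1 h1.2 h.1 h.2, ← partner_add N z h.1 h.2, N.partner_partner]
  · rw [off_outside N z h, off_outside N z (by omega)]
    ring

lemma off_ne {k : ℕ} (N : NCMatching k) (z : ZMod (2 * k)) (x : ℤ) : off N z x ≠ x := by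
  by_cases h : 0 ≤ x ∧ x < 2 * k
  · rw [Ne, off_eq_iff N z h.1 h.2 h.1 h.2]
    exact N.partner_ne _
  · rw [off_outside N z h]
    omega

lemma sbtw_add_intCast {k : ℕ} (z : ZMod (2 * k)) {x y w : ℤ} (hx : 0 ≤ x) (hx' : x < 2 * k)
    (hy : 0 ≤ y) (hy' : y < 2 * k) (hw : 0 ≤ w) (hw' : w < 2 * k) :
    sbtw (z + (x : ZMod (2 * k))) (z + y) (z + w) ↔
      x < y ∧ y < w ∨ y < w ∧ w < x ∨ w < x ∧ x < y := by
  have : NeZero (2 * k) := ⟨by omega⟩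
  rw [zmod_sbtw_add, zmod_sbtw_iff]
  have h1 := val_intCast_of_lt (k := k) x hx hx'
  have h2 := val_intCast_of_lt (k := k) y hy hy'
  have h3 := val_intCast_of_lt (k := k) w hw hw'
  omega

/-- No edge `{x, f x}` crosses an edge `{y, g y}` for `x` and `y` in the interval `[a, b]`. -/
def NoCross (f g : ℤ → ℤ) (a b : ℤ) : Prop :=
  ∀ x y, a ≤ x → x ≤ b → a ≤ y → y ≤ b →
    ¬ (x < y ∧ y < f x ∧ f x < g y) ∧ ¬ (y < x ∧ x < g y ∧ g y < f x)

lemma forall_not_crossing_iff {k : ℕ} (hk : k ≠ 0) (M N : NCMatching k) (z : ZMod (2 * k)) :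
    (∀ x y, ¬ Crossing x (M.partner x) y (N.partner y)) ↔
      NoCross (off M z) (off N z) 0 (2 * k - 1) := by
  constructor
  · intro h x y hx hx' hy hy'
    have h1 := off_mem M z hx (by omega)
    have h2 := off_mem N z hy (by omega)
    have h3 := h (z + x) (z + y)
    rw [partner_add M z hx (by omega), partner_add N z hy (by omega), Crossing,
      sbtw_add_intCast, sbtw_add_intCast, sbtw_add_intCast, sbtw_add_intCast] at h3 <;> omega
  · intro h x y
    obtain ⟨x, hx, hx', rfl⟩ := exists_offset hk z x
    obtain ⟨y, hy, hy', rfl⟩ := exists_offset hk z y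
    have h1 := off_mem M z hx hx'
    have h2 := off_mem N z hy hy'
    have k1 := off_off M z x
    have k2 := off_off N z y
    -- The integer condition fixes which end of each edge comes first, while `Crossing` does not;
    -- hence all four choices of ends are needed.
    have a1 := h x y hx (by omega) hy (by omega)
    have a2 := h (off M z x) y h1.1 (by omega) hy (by omega)
    have a3 := h x (off N z y) hx (by omega) h2.1 (by omega)
    have a4 := h (off M z x) (off N z y) h1.1 (by omega) h2.1 (by omega)
    rw [k1] at a2 a4
    rw [k2] at a3 a4
    rw [partner_add M z hx (by omega), partner_add N z hy (by omega), Crossing,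
      sbtw_add_intCast, sbtw_add_intCast, sbtw_add_intCast, sbtw_add_intCast] <;> omega

/-- The artificial pairs outside the interval are nested around it, so no range hypotheses are
needed. One order pattern suffices: two crossing edges of the same matching, taken at their smaller
ends, show it. -/
lemma off_nc {k : ℕ} (N : NCMatching k) (z : ZMod (2 * k)) (x y : ℤ) :
    ¬ (x < y ∧ y < off N z x ∧ off N z x < off N z y) := by
  rintro ⟨h1, h2, h3⟩
  by_cases hk : k = 0
  · subst hk
    rw [off_outside N z (by simp), off_outside N z (by simp)] at h3
    omega
  have h := (forall_not_crossing_iff hk N N z).1 N.not_crossing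
  by_cases hx : 0 ≤ x ∧ x < 2 * k
  · have := off_mem N z hx.1 hx.2
    exact (h x y (by omega) (by omega) (by omega) (by omega)).1 ⟨h1, h2, h3⟩
  · rw [off_outside N z hx] at h2 h3
    by_cases hy : 0 ≤ y ∧ y < 2 * k
    · have := off_mem N z hy.1 hy.2
      omega
    · rw [off_outside N z hy] at h3
      omega

/-- The matching `g` has no common edge with `f` on the interval `[a, b]`, and no edge of `g`
crosses an edge of `f` or of `g`. -/
structure Compat (f g : ℤ → ℤ) (a b : ℤ) : Prop where
  inv : ∀ x, g (g x) = x
  ne : ∀ x, g x ≠ x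
  nc : ∀ x y, ¬ (x < y ∧ y < g x ∧ g x < g y)
  cr : ∀ x y, ¬ (x < y ∧ y < f x ∧ f x < g y)
  cr' : ∀ x y, ¬ (y < x ∧ x < g y ∧ g y < f x)
  dj : ∀ x, a ≤ x → x ≤ b → f x ≠ g x

lemma disjCompat_iff {k : ℕ} (hk : k ≠ 0) (M N : NCMatching k) (z : ZMod (2 * k)) :
    DisjCompat M N ↔ (∀ x, 0 ≤ x → x ≤ 2 * (k : ℤ) - 1 → off M z x ≠ off N z x) ∧
      NoCross (off M z) (off N z) 0 (2 * k - 1) := by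
  rw [DisjCompat, forall_not_crossing_iff hk M N z]
  refine and_congr ⟨fun h x hx hx' he => ?_, fun h x he => ?_⟩ Iff.rfl
  · have h1 := partner_add M z hx (by omega)
    rw [he, ← partner_add N z hx (by omega)] at h1
    exact h _ h1
  · obtain ⟨x, hx, hx', rfl⟩ := exists_offset hk z x
    apply h x hx (by omega)
    have h1 := off_mem N z hx hx'
    rw [off_eq_iff M z hx hx' h1.1 h1.2, he, partner_add N z hx hx']

lemma DisjCompat.compat {k : ℕ} (hk : k ≠ 0) {M N : NCMatching k} (h : DisjCompat M N)
    (z : ZMod (2 * k)) : Compat (off M z) (off N z) 0 (2 * k - 1) := by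
  obtain ⟨h1, h2⟩ := (disjCompat_iff hk M N z).1 h
  refine ⟨off_off N z, off_ne N z, off_nc N z, fun x y ⟨a1, a2, a3⟩ => ?_,
    fun x y ⟨a1, a2, a3⟩ => ?_, h1⟩
  all_goals
    by_cases hx : 0 ≤ x ∧ x < 2 * k
    · have m1 := off_mem M z hx.1 hx.2
      by_cases hy : 0 ≤ y ∧ y < 2 * k
      · have m2 := off_mem N z hy.1 hy.2
        have m3 := h2 x y hx.1 (by omega) hy.1 (by omega)
        omega
      · rw [off_outside N z hy] at *
        omega
    · rw [off_outside M z hx] at *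
      by_cases hy : 0 ≤ y ∧ y < 2 * k
      · have m2 := off_mem N z hy.1 hy.2
        omega
      · rw [off_outside N z hy] at *
        omega

lemma pres_off {k : ℕ} (N : NCMatching k) (z : ZMod (2 * k)) :
    Pres (off N z) 0 (2 * k - 1) := by
  intro x hx hx'
  have := off_mem N z hx (by omega)
  omega

lemma adj_iff_disjCompat {k : ℕ} (M N : NCMatching k) :
    (DCM k).Adj M N ↔ DisjCompat M N := by
  refine ⟨fun h => h.2, fun h => ⟨?_, h⟩⟩
  rintro rfl
  exact h.1 0 rfl

lemma eq_of_off {k : ℕ} (hk : k ≠ 0) {M N : NCMatching k} (z : ZMod (2 * k))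
    (h : ∀ x, 0 ≤ x → x ≤ 2 * (k : ℤ) - 1 → off M z x = off N z x) : M = N := by
  ext x : 2
  obtain ⟨x, hx, hx', rfl⟩ := exists_offset hk z x
  rw [partner_add M z hx hx', partner_add N z hx hx', h x hx (by omega)]

/-! ### Drawings of matchings -/

/-- Drawings are defined over any commutative ring so that the same words apply to labels in `ZMod
(2 * k)` and to integer offsets, where linear arithmetic is available. Between `0` and `2 * k - 1`
nothing wraps around. -/
lemma drawn_off_iff_aux {k : ℕ} (N : NCMatching k) (z : ZMod (2 * k)) (w : List Piece)
    {a b : ℤ} (ha : 0 ≤ a) (hb : b < 2 * k) (hab : b = a + 2 * wsize w - 1) :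
    Drawn (off N z) w a b ↔ Drawn N.partner w (z + a) (z + b) := by
  induction w generalizing a b with
  | nil => simp [Drawn]
  | cons e w ih =>
    simp only [wsize] at hab
    push_cast at hab
    have hs := e.up_add_low
    rw [Drawn, Drawn, ih (by omega) (by omega) (by omega)]
    refine and_congr ?_ ?_
    · have hZ : ∀ x y : ℤ, 0 ≤ x → x < 2 * k → 0 ≤ y → y < 2 * k →
          (off N z x = y ↔ N.partner (z + x) = z + y) :=
        fun x y h1 h2 h3 h4 => off_eq_iff N z h1 h2 h3 h4
      have c1 : z + (a : ZMod (2 * k)) + 1 = z + ((a + 1 : ℤ) : ZMod (2 * k)) := by push_cast; ring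
      have c2 : z + (a : ZMod (2 * k)) + 2 = z + ((a + 2 : ℤ) : ZMod (2 * k)) := by push_cast; ring
      have c3 : z + (a : ZMod (2 * k)) + 3 = z + ((a + 3 : ℤ) : ZMod (2 * k)) := by push_cast; ring
      have d1 : z + (b : ZMod (2 * k)) - 1 = z + ((b - 1 : ℤ) : ZMod (2 * k)) := by push_cast; ring
      have d2 : z + (b : ZMod (2 * k)) - 2 = z + ((b - 2 : ℤ) : ZMod (2 * k)) := by push_cast; ring
      have d3 : z + (b : ZMod (2 * k)) - 3 = z + ((b - 3 : ℤ) : ZMod (2 * k)) := by push_cast; ring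
      rcases e with _ | s | s
      · simp only [size, DrawnPiece] at *
        rw [hZ, hZ] <;> omega
      · cases s
        · simp only [size, DrawnPiece, d1] at *
          rw [hZ, hZ] <;> omega
        · simp only [size, DrawnPiece, c1] at *
          rw [hZ, hZ] <;> omega
      · cases s
        · simp only [size, DrawnPiece, d1, d2, d3] at *
          rw [hZ, hZ, hZ, hZ] <;> omega
        · simp only [size, DrawnPiece, c1, c2, c3] at *
          rw [hZ, hZ, hZ, hZ] <;> omega
    · push_cast
      rw [add_assoc, add_sub_assoc]

lemma drawn_off_iff {k : ℕ} (N : NCMatching k) (z : ZMod (2 * k)) {w : List Piece}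
    (hw : wsize w = k) :
    Drawn (off N z) w 0 (2 * k - 1) ↔ Drawn N.partner w z (z - 1) := by
  rw [drawn_off_iff_aux N z w le_rfl (by omega) (by rw [hw]; ring)]
  have h : ((2 * k : ℕ) : ZMod (2 * k)) = 0 := ZMod.natCast_self _
  push_cast at h ⊢
  rw [h, add_zero, zero_sub, sub_eq_add_neg]

/-- A word determines the matching. Neighbours are identified through this lemma: a common drawing
is exhibited. -/
lemma eq_of_drawn {k : ℕ} (hk : k ≠ 0) {M N : NCMatching k} {z : ZMod (2 * k)} {w : List Piece}
    (hw : wsize w = k) (hM : Drawn M.partner w z (z - 1)) (hN : Drawn N.partner w z (z - 1)) :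
    M = N :=
  eq_of_off hk z (((drawn_off_iff M z hw).2 hM).unique ((drawn_off_iff N z hw).2 hN)
    (by rw [hw]; ring))

lemma DrawnPiece.congr {g g' : ℤ → ℤ} {e : Piece} {a b : ℤ} (h : DrawnPiece g a b e)
    (hb : a + 2 * e.size - 1 ≤ b) (hg : ∀ x, a ≤ x → x ≤ b → g' x = g x) :
    DrawnPiece g' a b e := by
  rcases e with _ | s | s
  · simp only [DrawnPiece, size] at *
    rwa [hg _ (by omega) (by omega), hg _ (by omega) (by omega)]
  · cases s <;> simp only [DrawnPiece, size] at *
    all_goals rwa [hg _ (by omega) (by omega), hg _ (by omega) (by omega)]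
  · cases s <;> simp only [DrawnPiece, size] at *
    all_goals rwa [hg _ (by omega) (by omega), hg _ (by omega) (by omega),
      hg _ (by omega) (by omega), hg _ (by omega) (by omega)]

lemma Drawn.congr {g g' : ℤ → ℤ} {w : List Piece} {a b : ℤ} (h : Drawn g w a b)
    (hb : b = a + 2 * wsize w - 1) (hg : ∀ x, a ≤ x → x ≤ b → g' x = g x) :
    Drawn g' w a b := by
  induction w generalizing a b with
  | nil => trivial
  | cons e w ih =>
    have hs := e.up_add_low
    simp only [wsize] at hb
    exact ⟨h.1.congr (by omega) hg,
      ih h.2 (by omega) fun x hx hx' => hg x (by omega) (by omega)⟩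

/-- Non-crossing matchings of `[a', b']` extended by a block of nested pairs on one side. -/
lemma exists_extend {g : ℤ → ℤ} {a b a' b' c : ℤ} (h1 : ∀ x, g (g x) = x) (h2 : ∀ x, g x ≠ x)
    (h3 : ∀ x y, ¬ (x < y ∧ y < g x ∧ g x < g y)) (hp : Pres g a' b')
    (hab : Odd (a + b)) (hc : Odd c) (ha : a ≤ a') (hb : b' ≤ b)
    (h : b' = b ∧ c = a + a' - 1 ∨ a' = a ∧ c = b + b' + 1) (hle : a' ≤ b' + 1) :
    ∃ g' : ℤ → ℤ, (∀ x, g' (g' x) = x) ∧ (∀ x, g' x ≠ x) ∧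
      (∀ x y, ¬ (x < y ∧ y < g' x ∧ g' x < g' y)) ∧
      (∀ x, ¬ (a ≤ x ∧ x ≤ b) → g' x = a + b - x) ∧
      (∀ x, a ≤ x → x ≤ b → ¬ (a' ≤ x ∧ x ≤ b') → g' x = c - x) ∧
      (∀ x, a' ≤ x → x ≤ b' → g' x = g x) := by
  obtain ⟨m, hm⟩ := hab
  obtain ⟨n, hn⟩ := hc
  let g' : ℤ → ℤ := fun x => if a' ≤ x ∧ x ≤ b' then g x else
    if a ≤ x ∧ x ≤ b then c - x else a + b - x
  have e1 : ∀ x, a' ≤ x → x ≤ b' → g' x = g x := fun x hx hx' => if_pos ⟨hx, hx'⟩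
  have e2 : ∀ x, a ≤ x → x ≤ b → ¬ (a' ≤ x ∧ x ≤ b') → g' x = c - x := fun x hx hx' hn =>
    (if_neg hn).trans (if_pos ⟨hx, hx'⟩)
  have e3 : ∀ x, ¬ (a ≤ x ∧ x ≤ b) → g' x = a + b - x := fun x hx =>
    (if_neg (by omega)).trans (if_neg hx)
  clear_value g'
  have e4 : ∀ x, (a' ≤ x ∧ x ≤ b' ∧ g' x = g x) ∨
      (a ≤ x ∧ x ≤ b ∧ ¬ (a' ≤ x ∧ x ≤ b') ∧ g' x = c - x) ∨
      (¬ (a ≤ x ∧ x ≤ b) ∧ g' x = a + b - x) := by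
    intro x
    have := e1 x
    have := e2 x
    have := e3 x
    omega
  refine ⟨g', fun x => ?_, fun x => ?_, fun x y => ?_, e3, e2, e1⟩
  · have h4 := e4 (g' x)
    have := hp x
    have h5 := h1 x
    rcases e4 x with hx | hx | hx
    · rw [hx.2.2] at h4 ⊢
      omega
    · omega
    · omega
  · have := e4 x
    have := h2 x
    omega
  · have := hp x
    have := hp y
    have := h3 x y
    have := e4 x
    have := e4 y
    omega

lemma exists_drawn_int (w : List Piece) : ∀ a b : ℤ, b = a + 2 * wsize w - 1 →
    ∃ g : ℤ → ℤ, (∀ x, g (g x) = x) ∧ (∀ x, g x ≠ x) ∧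
      (∀ x y, ¬ (x < y ∧ y < g x ∧ g x < g y)) ∧ (∀ x, ¬ (a ≤ x ∧ x ≤ b) → g x = a + b - x) ∧
      Drawn g w a b := by
  induction w with
  | nil =>
    intro a b hb
    simp only [wsize] at hb
    exact ⟨fun x => a + b - x, fun x => by dsimp only; omega, fun x => by dsimp only; omega,
      fun x y => by dsimp only; omega, fun x _ => rfl, trivial⟩
  | cons e w ih =>
    intro a b hb
    simp only [wsize] at hb
    have hs := e.up_add_low
    obtain ⟨g, h1, h2, h3, h4, h5⟩ := ih (a + e.up) (b - e.low) (by omega)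
    have hp := h5.pres (by omega)
    have hab : Odd (a + b) := ⟨a + e.size + wsize w - 1, by omega⟩
    rcases e with _ | s | s
    · simp only [up, low, size] at *
      push_cast at *
      -- No extension is needed for a D-edge: the pairs of `g` outside the smaller interval are
      -- nested around it, and the innermost one is `{a, b}`.
      refine ⟨g, h1, h2, h3, fun x hx => ?_, ⟨?_, ?_⟩, h5⟩
      · rw [h4 x (by omega)]; ring
      · rw [h4 a (by omega)]; ring
      · rw [h4 b (by omega)]; ring
    · cases s
      · simp only [up, low, size, if_false, Bool.false_eq_true] at *
        -- The reflection `x ↦ c - x` preserves the block of new points; `c` is the sum of the first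
        -- and the last of them, and is odd, so nothing is fixed.
        obtain ⟨g', k1, k2, k3, k4, k5, k6⟩ := exists_extend (c := 2 * b - 1) h1 h2 h3 hp hab
          ⟨b - 1, by ring⟩ (by omega) (by omega) (by omega) (by omega)
        refine ⟨g', k1, k2, k3, k4, ⟨?_, ?_⟩, h5.congr (by simp; omega) k6⟩
        all_goals rw [k5 _ (by omega) (by omega) (by omega)]; ring
      · simp only [up, low, size, if_true] at *
        obtain ⟨g', k1, k2, k3, k4, k5, k6⟩ := exists_extend (c := 2 * a + 1) h1 h2 h3 hp hab
          ⟨a, by ring⟩ (by omega) (by omega) (by omega) (by omega)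
        refine ⟨g', k1, k2, k3, k4, ⟨?_, ?_⟩, h5.congr (by simp; omega) k6⟩
        all_goals rw [k5 _ (by omega) (by omega) (by omega)]; ring
    · cases s
      · simp only [up, low, size, if_false, Bool.false_eq_true] at *
        obtain ⟨g', k1, k2, k3, k4, k5, k6⟩ := exists_extend (c := 2 * b - 3) h1 h2 h3 hp hab
          ⟨b - 2, by ring⟩ (by omega) (by omega) (by omega) (by omega)
        refine ⟨g', k1, k2, k3, k4, ⟨⟨?_, ?_⟩, ?_, ?_⟩, h5.congr (by simp; omega) k6⟩
        all_goals rw [k5 _ (by omega) (by omega) (by omega)]; ring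
      · simp only [up, low, size, if_true] at *
        obtain ⟨g', k1, k2, k3, k4, k5, k6⟩ := exists_extend (c := 2 * a + 3) h1 h2 h3 hp hab
          ⟨a + 1, by ring⟩ (by omega) (by omega) (by omega) (by omega)
        refine ⟨g', k1, k2, k3, k4, ⟨⟨?_, ?_⟩, ?_, ?_⟩, h5.congr (by simp; omega) k6⟩
        all_goals rw [k5 _ (by omega) (by omega) (by omega)]; ring

/-- This supplies the leaves: one of their two kinds contains a cap, which `stripMatching` cannot
draw. -/
lemma exists_drawn {k : ℕ} (hk : k ≠ 0) (z : ZMod (2 * k)) {w : List Piece} (hw : wsize w = k) :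
    ∃ N : NCMatching k, Drawn N.partner w z (z - 1) := by
  have hne : NeZero (2 * k) := ⟨by omega⟩
  obtain ⟨g, h1, h2, h3, h4, h5⟩ := exists_drawn_int w 0 (2 * k - 1) (by rw [hw]; ring)
  have hp := h5.pres (by rw [hw]; ring)
  have hv : ∀ x : ℤ, 0 ≤ x → x < 2 * k → ((z + (x : ZMod (2 * k)) - z).val : ℤ) = x := by
    intro x hx hx'
    rw [add_sub_cancel_left]
    exact val_intCast_of_lt x hx hx'
  have hinj : ∀ x y : ℤ, 0 ≤ x → x < 2 * k → 0 ≤ y → y < 2 * k →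
      z + (x : ZMod (2 * k)) = z + y → x = y := by
    intro x y hx hx' hy hy' h
    rw [← hv x hx hx', h, hv y hy hy']
  let P : ZMod (2 * k) → ZMod (2 * k) := fun x => z + (g ((x - z).val : ℤ) : ℤ)
  have hP : ∀ x : ℤ, 0 ≤ x → x < 2 * k → P (z + x) = z + (g x : ℤ) := by
    intro x hx hx'
    simp only [P]
    rw [hv x hx hx']
  let N : NCMatching k :=
    { partner := P
      partner_partner := by
        intro x
        obtain ⟨x, hx, hx', rfl⟩ := exists_offset hk z x
        have := hp x hx (by omega)
        rw [hP x hx hx', hP _ this.1 (by omega), h1]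
      partner_ne := by
        intro x
        obtain ⟨x, hx, hx', rfl⟩ := exists_offset hk z x
        have := hp x hx (by omega)
        rw [hP x hx hx']
        exact fun h => h2 x (hinj _ _ this.1 (by omega) hx hx' h)
      not_crossing := by
        intro x y
        obtain ⟨x, hx, hx', rfl⟩ := exists_offset hk z x
        obtain ⟨y, hy, hy', rfl⟩ := exists_offset hk z y
        have hgx := hp x hx (by omega)
        have hgy := hp y hy (by omega)
        have n1 := h3 x y
        have n2 := h3 x (g y)
        have n3 := h3 (g x) y
        have n4 := h3 (g x) (g y)
        have m1 := h3 y x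
        have m2 := h3 y (g x)
        have m3 := h3 (g y) x
        have m4 := h3 (g y) (g x)
        rw [h1] at n2 n3 n4 m2 m3 m4
        rw [h1] at n4 m4
        rw [hP x hx hx', hP y hy hy', Crossing, sbtw_add_intCast, sbtw_add_intCast,
          sbtw_add_intCast, sbtw_add_intCast] <;> omega }
  refine ⟨N, (drawn_off_iff N z hw).1 ?_⟩
  have hoff : ∀ x, 0 ≤ x → x ≤ 2 * (k : ℤ) - 1 → off N z x = g x := by
    intro x hx hx'
    have := hp x hx hx'
    rw [off_eq_iff N z hx (by omega) this.1 (by omega)]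
    exact hP x hx (by omega)
  have hfun : off N z = g := by
    funext x
    by_cases hx : 0 ≤ x ∧ x < 2 * k
    · exact hoff x hx.1 (by omega)
    · rw [off_outside N z hx, h4 x (by omega)]
      ring
  rwa [hfun]

/-- The edges of a strip drawing as pieces. -/
def StripEdge.toPiece : StripEdge → Piece
  | .D => .D
  | .B s => .B s

lemma wsize_map_toPiece (w : List StripEdge) : wsize (w.map StripEdge.toPiece) = w.length := by
  induction w with
  | nil => rfl
  | cons e w ih =>
    rcases e with _ | s <;> simp [wsize, StripEdge.toPiece, size, ih, add_comm]

lemma drawn_of_stripPartner {g : ℤ → ℤ} (w : List StripEdge) (a b : ℤ)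
    (hb : b = a + 2 * w.length - 1)
    (h : ∀ x : ℕ, x < 2 * w.length → g (a + x) = a + stripPartner w x) :
    Drawn g (w.map StripEdge.toPiece) a b := by
  induction w generalizing a b with
  | nil => trivial
  | cons e w ih =>
    simp only [List.length_cons] at h hb
    push_cast at hb
    match e with
    | .D =>
      have h0 := h 0 (by omega)
      have h1 := h (2 * w.length + 1) (by omega)
      simp only [stripPartner] at h0 h1
      simp at h0 h1
      refine ⟨⟨?_, ?_⟩, ih _ _ ?_ fun x hx => ?_⟩
      · rw [h0, hb]; ring
      · rw [show b = a + (2 * w.length + 1) by omega, h1]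
      · simp [StripEdge.toPiece, up, low]; omega
      · have h2 := h (x + 1) (by omega)
        simp only [stripPartner] at h2
        rw [if_neg (by omega), if_neg (by omega)] at h2
        simp [StripEdge.toPiece, up] at h2 ⊢
        rw [show a + 1 + (x : ℤ) = a + (x + 1) by ring, h2]; ring
    | .B true =>
      have h0 := h 0 (by omega)
      have h1 := h 1 (by omega)
      simp only [stripPartner] at h0 h1
      simp at h0 h1
      refine ⟨⟨h0, h1⟩, ih _ _ ?_ fun x hx => ?_⟩
      · simp [StripEdge.toPiece, up, low]; omega
      · have h2 := h (x + 2) (by omega)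
        simp only [stripPartner] at h2
        rw [if_neg (by omega), if_neg (by omega)] at h2
        simp [StripEdge.toPiece, up] at h2 ⊢
        rw [show a + 2 + (x : ℤ) = a + (x + 2) by ring, h2]; ring
    | .B false =>
      have h0 := h (2 * w.length) (by omega)
      have h1 := h (2 * w.length + 1) (by omega)
      simp only [stripPartner] at h0 h1
      simp at h0 h1
      refine ⟨⟨?_, ?_⟩, ih _ _ ?_ fun x hx => ?_⟩
      · rw [show b = a + (2 * w.length + 1) by omega, h1]; ring
      · rw [show b - 1 = a + 2 * w.length by omega, h0]; omega
      · simp [StripEdge.toPiece, up, low]; omega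
      · have h2 := h x (by omega)
        simp only [stripPartner] at h2
        rw [if_neg (by omega), if_neg (by omega)] at h2
        simp [StripEdge.toPiece, up] at h2 ⊢
        exact h2

lemma drawn_stripMatching {k : ℕ} (hk : k ≠ 0) (w : List StripEdge) (hw : w.length = k)
    (z : ZMod (2 * k)) :
    Drawn (stripMatching hk w hw z).partner (w.map StripEdge.toPiece) z (z - 1) := by
  rw [← drawn_off_iff _ z (by rw [wsize_map_toPiece, hw])]
  refine drawn_of_stripPartner w _ _ (by rw [hw]; ring) fun x hx => ?_
  have h1 := stripPartner_lt w x hx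
  rw [zero_add, zero_add, off_eq_iff _ z (by omega) (by omega) (by omega) (by omega)]
  have : NeZero (2 * k) := ⟨by omega⟩
  simp only [stripMatching, Int.cast_natCast, add_sub_cancel_left, ZMod.val_natCast]
  rw [Nat.mod_eq_of_lt (by omega)]

/-! ### Faces of a matching -/

/-- An involution without fixed points pairs off the points, so their number vanishes modulo 2. -/
lemma Pres.even_length {g : ℤ → ℤ} {a b : ℤ} (hp : Pres g a b) (h1 : ∀ x, g (g x) = x)
    (h2 : ∀ x, g x ≠ x) (hab : a ≤ b + 1) : Even (b + 1 - a) := by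
  have h : ∑ _x ∈ Finset.Icc a b, (1 : ZMod 2) = 0 :=
    Finset.sum_involution (fun x _ => g x) (fun _ _ => by decide) (fun x _ _ => h2 x)
      (fun x hx => by
        rw [Finset.mem_Icc] at hx ⊢
        exact hp x hx.1 hx.2)
      (fun x _ => h1 x)
  rw [Finset.sum_const, Int.card_Icc, nsmul_eq_mul, mul_one,
    ZMod.natCast_eq_zero_iff_even] at h
  obtain ⟨m, hm⟩ := h
  exact ⟨m, by omega⟩

namespace Compat

variable {f g : ℤ → ℤ} {a b a' b' : ℤ}

lemma mono (h : Compat f g a b) (ha : a ≤ a') (hb : b' ≤ b) : Compat f g a' b' :=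
  ⟨h.inv, h.ne, h.nc, h.cr, h.cr', fun x hx hx' => h.dj x (by omega) (by omega)⟩

lemma swap (h : Compat f g a b) {x y : ℤ} (hxy : g x = y) : g y = x := by rw [← hxy, h.inv]

lemma inside (h : Compat f g a b) {x y z : ℤ} (hx : g x = y) (hz : x < z) (hz' : z < y) :
    x < g z ∧ g z < y := by
  subst hx
  have h1 := h.nc x z
  have h2 := h.nc (g z) x
  have h3 := h.inv z
  have h4 := h.inv x
  rw [h3] at h2
  have h5 : g z ≠ g x := fun he => by rw [he] at h3; omega
  have h6 : g z ≠ x := fun he => by rw [he] at h3; omega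
  omega

/-- An involution that preserves two intervals preserves the points of the first that are not in the
second. These are the points of one face, which reduces the question to matchings of four, six or
eight points. -/
lemma outer (h : Compat f g a b) (hp : Pres g a b) (hp' : Pres g a' b') {x : ℤ} (hx : a ≤ x)
    (hx' : x ≤ b) (hn : ¬ (a' ≤ x ∧ x ≤ b')) :
    a ≤ g x ∧ g x ≤ b ∧ ¬ (a' ≤ g x ∧ g x ≤ b') := by
  have h1 := hp x hx hx'
  have h2 := hp' (g x)
  rw [h.inv] at h2
  omega

/-- The two ends of an edge of `f` have their `g`-partners on the same side of this edge. -/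
lemma side {c d : ℤ} (h : Compat f g a b) (ha : a ≤ c) (hb : d ≤ b) (hf : f c = d) (hf' : f d = c)
    (hcd : c < d) (hodd : Odd (d - c)) : Pres g c d ∨ Pres g (c + 1) (d - 1) := by
  have hin : ∀ x, c < x → x < d → c ≤ g x ∧ g x ≤ d := by
    intro x hx hx'
    have h1 := h.cr c x
    have h2 := h.cr' c (g x)
    rw [h.inv] at h2
    omega
  have hc := h.dj c ha (by omega)
  have hd := h.dj d (by omega) hb
  have hc' := h.ne c
  have hd' := h.ne d
  obtain ⟨m, hm⟩ := hodd
  have hinv := h.inv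
  by_cases h1 : c < g c ∧ g c < d
  · by_cases h2 : c < g d ∧ g d < d
    · left
      intro x hx hx'
      rcases eq_or_lt_of_le hx with rfl | hx
      · omega
      rcases eq_or_lt_of_le hx' with rfl | hx'
      · omega
      exact hin x hx hx'
    · exfalso
      -- If exactly one end is matched to the inside, the inner points together with this end form a
      -- preserved interval of odd length.
      have : Pres g c (d - 1) := by
        intro x hx hx'
        rcases eq_or_lt_of_le hx with rfl | hx
        · omega
        have h3 := hin x hx (by omega)
        have h4 : g x ≠ d := fun he => by have := h.swap he; omega
        omega
      obtain ⟨n, hn⟩ := this.even_length h.inv h.ne (by omega)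
      omega
  · by_cases h2 : c < g d ∧ g d < d
    · exfalso
      have : Pres g (c + 1) d := by
        intro x hx hx'
        rcases eq_or_lt_of_le hx' with rfl | hx'
        · omega
        have h3 := hin x (by omega) hx'
        have h4 : g x ≠ c := fun he => by have := h.swap he; omega
        omega
      obtain ⟨n, hn⟩ := this.even_length h.inv h.ne (by omega)
      omega
    · right
      intro x hx hx'
      have h3 := hin x (by omega) (by omega)
      have h4 : g x ≠ c := fun he => by have := h.swap he; omega
      have h5 : g x ≠ d := fun he => by have := h.swap he; omega
      omega

section
variable (h : Compat f g a b) {x₁ x₂ x₃ x₄ x₅ x₆ x₇ x₈ : ℤ}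
include h

/-- Four points have two non-crossing matchings, each formed by two opposite sides of the
quadrilateral; `f` draws one of them, which leaves the other for `g`. The variant `quad'` treats the
opposite choice. -/
lemma quad (h1 : x₁ < x₂) (h2 : x₂ < x₃) (h3 : x₃ < x₄)
    (m1 : g x₁ = x₁ ∨ g x₁ = x₂ ∨ g x₁ = x₃ ∨ g x₁ = x₄)
    (m4 : g x₄ = x₁ ∨ g x₄ = x₂ ∨ g x₄ = x₃ ∨ g x₄ = x₄)
    (n1 : g x₁ ≠ x₄) (n2 : g x₂ ≠ x₃) :
    g x₁ = x₂ ∧ g x₂ = x₁ ∧ g x₃ = x₄ ∧ g x₄ = x₃ := by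
  have e1 := h.ne x₁
  have e4 := h.ne x₄
  have c1 := h.swap (x := x₁) (y := x₂)
  have c2 := h.swap (x := x₁) (y := x₃)
  have c3 := h.swap (x := x₄) (y := x₂)
  have c4 := h.swap (x := x₄) (y := x₃)
  have c5 := h.swap (x := x₄) (y := x₁)
  have c6 := h.nc x₁ x₂
  omega

lemma quad' (h1 : x₁ < x₂) (h2 : x₂ < x₃) (h3 : x₃ < x₄)
    (m1 : g x₁ = x₁ ∨ g x₁ = x₂ ∨ g x₁ = x₃ ∨ g x₁ = x₄)
    (m2 : g x₂ = x₁ ∨ g x₂ = x₂ ∨ g x₂ = x₃ ∨ g x₂ = x₄)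
    (n1 : g x₁ ≠ x₂) :
    g x₁ = x₄ ∧ g x₄ = x₁ ∧ g x₂ = x₃ ∧ g x₃ = x₂ := by
  have e1 := h.ne x₁
  have e2 := h.ne x₂
  have c1 := h.swap (x := x₁) (y := x₃)
  have c2 := h.swap (x := x₁) (y := x₄)
  have c3 := h.swap (x := x₂) (y := x₃)
  have c4 := h.swap (x := x₂) (y := x₄)
  have c5 := h.swap (x := x₂) (y := x₁)
  have c6 := h.nc x₁ x₂
  omega

lemma outside {x y z : ℤ} (hx : g x = y) (hz : z < x ∨ y < z) (hxy : x < y) :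
    g z < x ∨ y < g z := by
  have h1 := h.inside hx (z := g z)
  have h2 := h.inv z
  have h3 := h.swap hx
  have h4 : g z ≠ x := fun he => by rw [he] at h2; omega
  have h5 : g z ≠ y := fun he => by rw [he] at h2; omega
  omega

/-- Of the five non-crossing matchings of a hexagon, two avoid `x₂x₃` and `x₄x₅`. The pair `x₁x₆` is
not excluded here, because `octa` applies this to `x₃, …, x₈`, where `x₃x₈` is allowed. -/
lemma hexa (h1 : x₁ < x₂) (h2 : x₂ < x₃) (h3 : x₃ < x₄) (h4 : x₄ < x₅) (h5 : x₅ < x₆)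
    (m : ∀ y, (y = x₁ ∨ y = x₂ ∨ y = x₃ ∨ y = x₄ ∨ y = x₅ ∨ y = x₆) →
      (g y = x₁ ∨ g y = x₂ ∨ g y = x₃ ∨ g y = x₄ ∨ g y = x₅ ∨ g y = x₆))
    (n2 : g x₂ ≠ x₃) (n4 : g x₄ ≠ x₅) :
    ((g x₁ = x₂ ∧ g x₂ = x₁) ∧ (g x₃ = x₄ ∧ g x₄ = x₃) ∧ g x₅ = x₆ ∧ g x₆ = x₅) ∨
    ((g x₁ = x₆ ∧ g x₆ = x₁) ∧ (g x₂ = x₅ ∧ g x₅ = x₂) ∧ g x₃ = x₄ ∧ g x₄ = x₃) := by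
  rcases m x₁ (by simp) with k | k | k | k | k | k
  · exact absurd k (h.ne _)
  · left
    have k2 := h.swap k
    have o3 := h.outside k (z := x₃) (by omega) h1
    rcases m x₃ (by simp) with l | l | l | l | l | l
    · exfalso; omega
    · exfalso; omega
    · exact absurd l (h.ne _)
    · have l2 := h.swap l
      have o5 := h.outside k (z := x₅) (by omega) h1
      have p5 := h.outside l (z := x₅) (by omega) h3
      have r : g x₅ = x₆ := by
        rcases m x₅ (by simp) with q | q | q | q | q | q <;>
          first | exact q | exact absurd q (h.ne _) | (exfalso; omega)
      exact ⟨⟨k, k2⟩, ⟨l, l2⟩, r, h.swap r⟩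
    · have := h.inside l h3 (by omega)
      rcases m x₄ (by simp) with q | q | q | q | q | q <;>
        first | exact absurd q (h.ne _) | exact absurd q n4 | (exfalso; omega)
    · have i4 := h.inside l h3 (by omega)
      rcases m x₄ (by simp) with q | q | q | q | q | q <;>
        first | exact absurd q (h.ne _) | exact absurd q n4 | (exfalso; omega)
  · have := h.inside k h1 h2
    rcases m x₂ (by simp) with q | q | q | q | q | q <;>
      first | exact absurd q (h.ne _) | exact absurd q n2 | (exfalso; omega)
  · have := h.inside k h1 (by omega)
    rcases m x₂ (by simp) with q | q | q | q | q | q <;>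
      first | exact absurd q (h.ne _) | exact absurd q n2 | (exfalso; omega)
  · exfalso
    have i2 := h.inside k h1 (by omega)
    have l : g x₂ = x₄ := by
      rcases m x₂ (by simp) with q | q | q | q | q | q <;>
        first | exact q | exact absurd q (h.ne _) | exact absurd q n2 | (exfalso; omega)
    have i3 := h.inside l h2 h3
    rcases m x₃ (by simp) with q | q | q | q | q | q <;>
      first | exact absurd q (h.ne _) | (exfalso; omega)
  · right
    have i2 := h.inside k h1 (by omega)
    rcases m x₂ (by simp) with l | l | l | l | l | l
    · exfalso; omega
    · exact absurd l (h.ne _)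
    · exact absurd l n2
    · have i3 := h.inside l h2 h3
      rcases m x₃ (by simp) with q | q | q | q | q | q <;>
        first | exact absurd q (h.ne _) | (exfalso; omega)
    · have i3 := h.inside l h2 (by omega)
      have r : g x₃ = x₄ := by
        rcases m x₃ (by simp) with q | q | q | q | q | q <;>
          first | exact q | exact absurd q (h.ne _) | (exfalso; omega)
      exact ⟨⟨k, h.swap k⟩, ⟨l, h.swap l⟩, r, h.swap r⟩
    · exfalso; omega

/-- Three alternate sides are excluded, and every matching containing a long diagonal uses one of
them. Only the other three sides remain. -/
lemma hexa' (h1 : x₁ < x₂) (h2 : x₂ < x₃) (h3 : x₃ < x₄) (h4 : x₄ < x₅) (h5 : x₅ < x₆)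
    (m : ∀ y, (y = x₁ ∨ y = x₂ ∨ y = x₃ ∨ y = x₄ ∨ y = x₅ ∨ y = x₆) →
      (g y = x₁ ∨ g y = x₂ ∨ g y = x₃ ∨ g y = x₄ ∨ g y = x₅ ∨ g y = x₆))
    (n1 : g x₁ ≠ x₂) (n3 : g x₃ ≠ x₄) (n5 : g x₅ ≠ x₆) :
    (g x₁ = x₆ ∧ g x₆ = x₁) ∧ (g x₂ = x₃ ∧ g x₃ = x₂) ∧ g x₄ = x₅ ∧ g x₅ = x₄ := by
  rcases m x₁ (by simp) with k | k | k | k | k | k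
  · exact absurd k (h.ne _)
  · exact absurd k n1
  · have := h.inside k h1 h2
    rcases m x₂ (by simp) with q | q | q | q | q | q <;>
      first | exact absurd q (h.ne _) | (exfalso; omega)
  · have := h.outside k (z := x₅) (by omega) (by omega)
    rcases m x₅ (by simp) with q | q | q | q | q | q <;>
      first | exact absurd q (h.ne _) | exact absurd q n5 | (exfalso; omega)
  · have := h.outside k (z := x₆) (by omega) (by omega)
    rcases m x₆ (by simp) with q | q | q | q | q | q <;>
      first | exact absurd q (h.ne _) | (exfalso; omega)
  · have i2 := h.inside k h1 (by omega)
    rcases m x₂ (by simp) with l | l | l | l | l | l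
    · exfalso; omega
    · exact absurd l (h.ne _)
    · have o4 := h.outside l (z := x₄) (by omega) (by omega)
      have i4 := h.inside k (z := x₄) (by omega) (by omega)
      have r : g x₄ = x₅ := by
        rcases m x₄ (by simp) with q | q | q | q | q | q <;>
          first | exact q | exact absurd q (h.ne _) | (exfalso; omega)
      exact ⟨⟨k, h.swap k⟩, ⟨l, h.swap l⟩, r, h.swap r⟩
    · have i3 := h.inside l h2 h3
      rcases m x₃ (by simp) with q | q | q | q | q | q <;>
        first | exact absurd q (h.ne _) | exact absurd q n3 | (exfalso; omega)
    · have i3 := h.inside l h2 (by omega)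
      rcases m x₃ (by simp) with q | q | q | q | q | q <;>
        first | exact absurd q (h.ne _) | exact absurd q n3 | (exfalso; omega)
    · exfalso; omega

/-- The excluded pairs are four alternate sides of an octagon. The partner of `x₁` decides: `x₂`
leaves the hexagon `x₃, …, x₈`, while `x₆` forces everything else, and no other partner is possible.
The two survivors other than the alternate sides are the source of the leaves. -/
lemma octa (h1 : x₁ < x₂) (h2 : x₂ < x₃) (h3 : x₃ < x₄) (h4 : x₄ < x₅) (h5 : x₅ < x₆)
    (h6 : x₆ < x₇) (h7 : x₇ < x₈)
    (m : ∀ y, (y = x₁ ∨ y = x₂ ∨ y = x₃ ∨ y = x₄ ∨ y = x₅ ∨ y = x₆ ∨ y = x₇ ∨ y = x₈) →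
      (g y = x₁ ∨ g y = x₂ ∨ g y = x₃ ∨ g y = x₄ ∨ g y = x₅ ∨ g y = x₆ ∨ g y = x₇ ∨ g y = x₈))
    (n1 : g x₁ ≠ x₈) (n2 : g x₂ ≠ x₃) (n4 : g x₄ ≠ x₅) (n6 : g x₆ ≠ x₇) :
    ((g x₁ = x₂ ∧ g x₂ = x₁) ∧ (g x₃ = x₄ ∧ g x₄ = x₃) ∧ (g x₅ = x₆ ∧ g x₆ = x₅) ∧
      g x₇ = x₈ ∧ g x₈ = x₇) ∨
    ((g x₁ = x₂ ∧ g x₂ = x₁) ∧ (g x₃ = x₈ ∧ g x₈ = x₃) ∧ (g x₄ = x₇ ∧ g x₇ = x₄) ∧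
      g x₅ = x₆ ∧ g x₆ = x₅) ∨
    ((g x₁ = x₆ ∧ g x₆ = x₁) ∧ (g x₂ = x₅ ∧ g x₅ = x₂) ∧ (g x₃ = x₄ ∧ g x₄ = x₃) ∧
      g x₇ = x₈ ∧ g x₈ = x₇) := by
  rcases m x₁ (by simp) with k | k | k | k | k | k | k | k
  · exact absurd k (h.ne _)
  · have k2 := h.swap k
    have m' : ∀ y, (y = x₃ ∨ y = x₄ ∨ y = x₅ ∨ y = x₆ ∨ y = x₇ ∨ y = x₈) →
        (g y = x₃ ∨ g y = x₄ ∨ g y = x₅ ∨ g y = x₆ ∨ g y = x₇ ∨ g y = x₈) := by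
      intro y hy
      have h8 := h.outside k (z := y) (by omega) h1
      have q1 : g y ≠ x₁ := by omega
      have q2 : g y ≠ x₂ := by omega
      simpa [q1, q2] using m y (Or.inr (Or.inr hy))
    rcases h.hexa h3 h4 h5 h6 h7 m' n4 n6 with hh | hh
    · exact Or.inl ⟨⟨k, k2⟩, hh⟩
    · exact Or.inr (Or.inl ⟨⟨k, k2⟩, hh⟩)
  · have := h.inside k h1 h2
    rcases m x₂ (by simp) with q | q | q | q | q | q | q | q <;>
      first | exact absurd q (h.ne _) | exact absurd q n2 | (exfalso; omega)
  · have := h.inside k h1 (by omega)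
    rcases m x₂ (by simp) with q | q | q | q | q | q | q | q <;>
      first | exact absurd q (h.ne _) | exact absurd q n2 | (exfalso; omega)
  · exfalso
    have i2 := h.inside k h1 (by omega)
    have l : g x₂ = x₄ := by
      rcases m x₂ (by simp) with q | q | q | q | q | q | q | q <;>
        first | exact q | exact absurd q (h.ne _) | exact absurd q n2 | (exfalso; omega)
    have i3 := h.inside l h2 h3
    rcases m x₃ (by simp) with q | q | q | q | q | q | q | q <;>
      first | exact absurd q (h.ne _) | (exfalso; omega)
  · right; right
    have i2 := h.inside k h1 (by omega)
    have o7 := h.outside k (z := x₇) (by omega) (by omega)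
    have r7 : g x₇ = x₈ := by
      rcases m x₇ (by simp) with q | q | q | q | q | q | q | q <;>
        first | exact q | exact absurd q (h.ne _) | (exfalso; omega)
    have l : g x₂ = x₅ := by
      rcases m x₂ (by simp) with l | l | l | l | l | l | l | l
      · exfalso; omega
      · exact absurd l (h.ne _)
      · exact absurd l n2
      · have i3 := h.inside l h2 h3
        rcases m x₃ (by simp) with q | q | q | q | q | q | q | q <;>
          first | exact absurd q (h.ne _) | (exfalso; omega)
      · exact l
      all_goals exfalso; omega
    have i3 := h.inside l h2 (by omega)
    have r : g x₃ = x₄ := by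
      rcases m x₃ (by simp) with q | q | q | q | q | q | q | q <;>
        first | exact q | exact absurd q (h.ne _) | (exfalso; omega)
    exact ⟨⟨k, h.swap k⟩, ⟨l, h.swap l⟩, ⟨r, h.swap r⟩, r7, h.swap r7⟩
  · have := h.outside k (z := x₈) (by omega) (by omega)
    rcases m x₈ (by simp) with q | q | q | q | q | q | q | q <;>
      first | exact absurd q (h.ne _) | (exfalso; omega)
  · exact absurd k n1

end

end Compat

/-! ### The neighbours of a drawing, face by face -/

namespace Compat

variable {f g : ℤ → ℤ} {a b a' b' : ℤ}

/-- The interval from `a'` to `b'` is what lies to the right of the face. The two `Pres` hypotheses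
encode the assignment of edges: exactly the edges of the displayed word belong to this face. The
other face lemmas have the same format. -/
lemma face_DB (h : Compat f g a b) (hp : Pres g a b) (hp' : Pres g a' b') {s : Bool}
    (hf : Drawn f [D, B s] a b) (ha : a' = a + wup [D, B s]) (hb : b' = b - wlow [D, B s])
    (hle : a' ≤ b' + 1) : Drawn g [B s, D] a b := by
  have hm : ∀ y, a ≤ y → y ≤ b → ¬ (a' ≤ y ∧ y ≤ b') → _ := fun y => h.outer hp hp'
  have hd := h.dj
  cases s <;> norm_num [Drawn, DrawnPiece, wup, wlow, up, low, add_assoc, sub_sub] at *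
  · have d1 := hd a
    have d2 := hd (b - 1)
    have m1 := hm a
    have m4 := hm b
    have := h.quad (x₁ := a) (x₂ := b - 2) (x₃ := b - 1) (x₄ := b) (by omega) (by omega)
      (by omega) (by omega) (by omega) (by omega) (by have := h.swap (x := b - 2) (y := b - 1); omega)
    omega
  · have d1 := hd a
    have d2 := hd (a + 1)
    have m1 := hm a
    have m4 := hm b
    have := h.quad (x₁ := a) (x₂ := a + 1) (x₃ := a + 2) (x₄ := b) (by omega) (by omega)
      (by omega) (by omega) (by omega) (by omega) (by omega)
    omega

lemma face_BD (h : Compat f g a b) (hp : Pres g a b) (hp' : Pres g a' b') {s : Bool}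
    (hf : Drawn f [B s, D] a b) (ha : a' = a + wup [B s, D]) (hb : b' = b - wlow [B s, D])
    (hle : a' ≤ b' + 1) : Drawn g [D, B s] a b := by
  have hm : ∀ y, a ≤ y → y ≤ b → ¬ (a' ≤ y ∧ y ≤ b') → _ := fun y => h.outer hp hp'
  have hd := h.dj
  cases s <;> norm_num [Drawn, DrawnPiece, wup, wlow, up, low, add_assoc, sub_sub] at *
  · have d1 := hd a
    have m1 := hm a
    have m4 := hm (b - 2)
    have := h.quad' (x₁ := a) (x₂ := b - 2) (x₃ := b - 1) (x₄ := b) (by omega) (by omega)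
      (by omega) (by omega) (by omega) (by omega)
    omega
  · have d1 := hd a
    have m1 := hm a
    have m4 := hm (a + 1)
    have := h.quad' (x₁ := a) (x₂ := a + 1) (x₃ := a + 2) (x₄ := b) (by omega) (by omega)
      (by omega) (by omega) (by omega) (by omega)
    omega

lemma face_DBD (h : Compat f g a b) (hp : Pres g a b) (hp' : Pres g a' b') {s : Bool}
    (hf : Drawn f [D, B s, D] a b) (ha : a' = a + wup [D, B s, D])
    (hb : b' = b - wlow [D, B s, D]) (hle : a' ≤ b' + 1) : Drawn g [B s, B s, B !s] a b := by
  have hm : ∀ y, a ≤ y → y ≤ b → ¬ (a' ≤ y ∧ y ≤ b') → _ := fun y => h.outer hp hp'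
  have hd := h.dj
  cases s <;> norm_num [Drawn, DrawnPiece, wup, wlow, up, low, add_assoc, sub_sub] at *
  · have d1 := hd a
    have d2 := hd (a + 1)
    have d3 := hd (b - 2)
    have d4 := h.swap (x := b - 2) (y := b - 1)
    rcases h.hexa (x₁ := a) (x₂ := a + 1) (x₃ := b - 3) (x₄ := b - 2) (x₅ := b - 1) (x₆ := b)
      (by omega) (by omega) (by omega) (by omega) (by omega)
      (fun y hy => by have := hm y; omega) (by omega) (by omega) <;> omega
  · have d1 := hd a
    have d2 := hd (a + 1)
    have d3 := hd (a + 3)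
    rcases h.hexa (x₁ := a) (x₂ := a + 1) (x₃ := a + 2) (x₄ := a + 3) (x₅ := b - 1) (x₆ := b)
      (by omega) (by omega) (by omega) (by omega) (by omega)
      (fun y hy => by have := hm y; omega) (by omega) (by omega) <;> omega

lemma face_BBB (h : Compat f g a b) (hp : Pres g a b) (hp' : Pres g a' b') {s : Bool}
    (hf : Drawn f [B s, B s, B !s] a b) (ha : a' = a + wup [B s, B s, B !s])
    (hb : b' = b - wlow [B s, B s, B !s]) (hle : a' ≤ b' + 1) : Drawn g [D, B s, D] a b := by
  have hm : ∀ y, a ≤ y → y ≤ b → ¬ (a' ≤ y ∧ y ≤ b') → _ := fun y => h.outer hp hp'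
  have hd := h.dj
  cases s <;> norm_num [Drawn, DrawnPiece, wup, wlow, up, low, add_assoc, sub_sub] at *
  · have d1 := hd a
    have d2 := hd (b - 3)
    have d3 := hd (b - 1)
    have := h.hexa' (x₁ := a) (x₂ := a + 1) (x₃ := b - 3) (x₄ := b - 2) (x₅ := b - 1) (x₆ := b)
      (by omega) (by omega) (by omega) (by omega) (by omega)
      (fun y hy => by have := hm y; omega) (by omega) (by omega) (by omega)
    omega
  · have d1 := hd a
    have d2 := hd (a + 2)
    have d3 := hd (b - 1)
    have := h.hexa' (x₁ := a) (x₂ := a + 1) (x₃ := a + 2) (x₄ := a + 3) (x₅ := b - 1) (x₆ := b)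
      (by omega) (by omega) (by omega) (by omega) (by omega)
      (fun y hy => by have := hm y; omega) (by omega) (by omega) (by omega)
    omega

lemma face_DBBB (h : Compat f g a b) (hp : Pres g a b) (hp' : Pres g a' b') {s : Bool}
    (hf : Drawn f [D, B s, B s, B !s] a b) (ha : a' = a + wup [D, B s, B s, B !s])
    (hb : b' = b - wlow [D, B s, B s, B !s]) (hle : a' ≤ b' + 1) :
    Drawn g [B s, B s, B !s, D] a b ∨ Drawn g [B s, D, D, D] a b ∨
      Drawn g [B !s, D, C s] a b := by
  have hm : ∀ y, a ≤ y → y ≤ b → ¬ (a' ≤ y ∧ y ≤ b') → _ := fun y => h.outer hp hp'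
  have hd := h.dj
  cases s <;> norm_num [Drawn, DrawnPiece, wup, wlow, up, low, add_assoc, sub_sub] at *
  · have d1 := hd a
    have d2 := hd (a + 1)
    have d3 := hd (b - 4)
    have d4 := hd (b - 2)
    rcases h.octa (x₁ := a) (x₂ := a + 1) (x₃ := a + 2) (x₄ := b - 4) (x₅ := b - 3)
      (x₆ := b - 2) (x₇ := b - 1) (x₈ := b)
      (by omega) (by omega) (by omega) (by omega) (by omega) (by omega) (by omega)
      (fun y hy => by have := hm y; omega) (by omega) (by omega) (by omega) (by omega)
      with hh | hh | hh
    · left; omega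
    -- For `s = false` the two B-edges of side `s` are on the lower side, so the last two matchings
    -- of the octagon exchange their roles.
    · right; right; omega
    · right; left; omega
  · have d1 := hd a
    have d2 := hd (a + 1)
    have d3 := hd (a + 3)
    have d4 := hd (b - 2)
    rcases h.octa (x₁ := a) (x₂ := a + 1) (x₃ := a + 2) (x₄ := a + 3) (x₅ := a + 4)
      (x₆ := b - 2) (x₇ := b - 1) (x₈ := b)
      (by omega) (by omega) (by omega) (by omega) (by omega) (by omega) (by omega)
      (fun y hy => by have := hm y; omega) (by omega) (by omega) (by omega) (by omega)
      with hh | hh | hh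
    · left; omega
    · right; left; omega
    · right; right; omega

end Compat

/-! ### Drawings of EDB-matchings and of their neighbours -/

/-- Elements consisting of a D-edge followed by a B-edge. -/
def dbWord : List Bool → List Piece
  | [] => []
  | s :: ps => D :: B s :: dbWord ps

/-- Elements consisting of a B-edge followed by a D-edge. -/
def bdWord : List Bool → List Piece
  | [] => []
  | s :: ps => B s :: D :: bdWord ps

/-- The drawing of an EDB-matching with positions `ps ++ s :: qs`. -/
def mWord (ps : List Bool) (s : Bool) (qs : List Bool) : List Piece :=
  dbWord ps ++ D :: B s :: B s :: B (!s) :: dbWord qs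

/-- The drawing of the half-turn of an EDB-matching. -/
def nWord (ps : List Bool) (s : Bool) (qs : List Bool) : List Piece :=
  bdWord ps ++ B s :: B s :: B (!s) :: D :: bdWord qs

/-- The drawing of a leaf. -/
def leafWord : Bool → List Bool → Bool → List Bool → List Piece
  | true, ps, s, qs => bdWord ps ++ B s :: D :: D :: D :: bdWord qs
  | false, ps, s, qs => bdWord ps ++ B (!s) :: D :: C s :: bdWord qs

/-- An alternating sequence of D-edges and B-edges can be grouped either way; this shifts the
grouping when a D-edge is assigned to the face on its left. -/
lemma dbWord_append_D (ps : List Bool) (w : List Piece) :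
    dbWord ps ++ D :: w = D :: (bdWord ps ++ w) := by
  induction ps with
  | nil => rfl
  | cons p ps ih => simp [dbWord, bdWord, ih]

lemma bdWord_append (ps qs : List Bool) : bdWord (ps ++ qs) = bdWord ps ++ bdWord qs := by
  induction ps with
  | nil => rfl
  | cons p ps ih => simp [bdWord, ih]

lemma wsize_dbWord (ps : List Bool) : wsize (dbWord ps) = 2 * ps.length := by
  induction ps with
  | nil => rfl
  | cons p ps ih => simp only [dbWord, wsize, size, ih, List.length_cons]; omega

lemma wsize_bdWord (ps : List Bool) : wsize (bdWord ps) = 2 * ps.length := by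
  induction ps with
  | nil => rfl
  | cons p ps ih => simp only [bdWord, wsize, size, ih, List.length_cons]; omega

lemma wsize_mWord (ps : List Bool) (s : Bool) (qs : List Bool) :
    wsize (mWord ps s qs) = 2 * (ps ++ s :: qs).length + 2 := by
  simp only [mWord, wsize_append, wsize, size, wsize_dbWord, List.length_append, List.length_cons]
  omega

lemma wsize_nWord (ps : List Bool) (s : Bool) (qs : List Bool) :
    wsize (nWord ps s qs) = 2 * (ps ++ s :: qs).length + 2 := by
  simp only [nWord, wsize_append, wsize, size, wsize_bdWord, List.length_append, List.length_cons]
  omega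

lemma wsize_leafWord (c : Bool) (ps : List Bool) (s : Bool) (qs : List Bool) :
    wsize (leafWord c ps s qs) = 2 * (ps ++ s :: qs).length + 2 := by
  cases c <;>
  · simp only [leafWord, wsize_append, wsize, size, wsize_bdWord, List.length_append,
      List.length_cons]
    omega

/-! ### Forced assignments of edges to faces -/

section
variable {f g : ℤ → ℤ} {a b : ℤ}

lemma end_eq_of_size {u w : List Piece} (hb : b = a + 2 * wsize (u ++ w) - 1) :
    b - wlow u = a + wup u + 2 * wsize w - 1 := by
  have := wup_add_wlow u
  rw [wsize_append] at hb
  push_cast at hb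
  omega

lemma Compat.side_word {w : List Piece} (h : Compat f g a b) (hf : Drawn f (D :: w) a b)
    (hb : b = a + 2 * wsize (D :: w) - 1) : Pres g a b ∨ Pres g (a + 1) (b - 1) := by
  simp only [wsize, size] at hb
  exact h.side le_rfl le_rfl hf.1.1 hf.1.2 (by omega) ⟨wsize w, by omega⟩

/-- A B-edge alone in its face would have its two ends matched to each other, which gives a common
edge. -/
lemma Compat.not_pres_B {s : Bool} {w : List Piece} (h : Compat f g a b)
    (hf : Drawn f (B s :: w) a b) (hb : b = a + 2 * wsize (B s :: w) - 1) (hp : Pres g a b) :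
    ¬ Pres g (a + up (B s)) (b - low (B s)) := by
  intro hp'
  have hf := hf.1
  simp only [wsize, size] at hb
  cases s <;> simp [DrawnPiece, up, low] at hf hp'
  · have := h.outer hp hp' (x := b) (by omega) (by omega) (by omega)
    have := h.dj b
    have := h.ne b
    omega
  · have := h.outer hp hp' (x := a) (by omega) (by omega) (by omega)
    have := h.dj a
    have := h.ne a
    omega

/-- The D-edge cannot go right, since the B-edge would then be alone. So it goes left, and the rest
of the strip is preserved again: the situation repeats one step further to the right. -/
lemma Compat.step_BD {s : Bool} {w : List Piece} (h : Compat f g a b)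
    (hf : Drawn f (B s :: D :: w) a b) (hb : b = a + 2 * wsize (B s :: D :: w) - 1)
    (hp : Pres g a b) :
    Drawn g [D, B s] a b ∧ Pres g (a + wup [D, B s]) (b - wlow [D, B s]) ∧
      Drawn f w (a + wup [D, B s]) (b - wlow [D, B s]) ∧
      b - wlow [D, B s] = a + wup [D, B s] + 2 * wsize w - 1 := by
  have e1 : wup [B s, D] = wup [D, B s] := by cases s <;> rfl
  have e2 : wlow [B s, D] = wlow [D, B s] := by cases s <;> rfl
  have hs := end_eq_of_size (u := [B s, D]) hb
  obtain ⟨h1, h2⟩ := (drawn_append f [B s, D] w a b).1 hf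
  have hs' := end_eq_of_size (u := [B s]) (w := D :: w) hb
  have h3 : Drawn f (D :: w) (a + wup [B s]) (b - wlow [B s]) := by
    simpa [wup, wlow] using hf.2
  rw [e1, e2] at hs h2
  rcases (h.mono (by omega) (by omega)).side_word h3 hs' with hq | hq
  · exact absurd hq (by simpa [wup, wlow] using h.not_pres_B hf hb hp)
  · have hq' : Pres g (a + wup [D, B s]) (b - wlow [D, B s]) := by
      rw [← e1, ← e2]
      convert hq using 1 <;> simp [wup, wlow, up, low] <;> ring
    refine ⟨h.face_BD hp hq' h1 (by rw [e1]) (by rw [e2]) (by omega), hq', h2, hs⟩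

/-- By `step_BD` each B-edge takes the D-edge on its right, and the last B-edge finds none. -/
lemma Compat.not_pres_BDB {s : Bool} {ps : List Bool} (h : Compat f g a b)
    (hf : Drawn f (B s :: dbWord ps) a b) (hb : b = a + 2 * wsize (B s :: dbWord ps) - 1) :
    ¬ Pres g a b := by
  induction ps generalizing s a b with
  | nil =>
    intro hp
    refine h.not_pres_B hf hb hp fun x hx hx' => ?_
    have : (B s).up + (B s).low = 2 := by cases s <;> rfl
    simp only [wsize, size, dbWord] at hb
    omega
  | cons p ps ih =>
    intro hp
    obtain ⟨-, h1, h2, h3⟩ := h.step_BD hf hb hp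
    exact ih (h.mono (by omega) (by omega)) h2 h3 h1

/-- If the first D-edge went left, the rest would be a situation excluded by `not_pres_BDB`. -/
lemma Compat.pres_dbWord {ps : List Bool} (h : Compat f g a b) (hf : Drawn f (dbWord ps) a b)
    (hb : b = a + 2 * wsize (dbWord ps) - 1) : Pres g a b := by
  cases ps with
  | nil =>
    intro x
    simp only [dbWord, wsize] at hb
    omega
  | cons p ps =>
    refine (h.side_word hf hb).resolve_right ?_
    have hs := end_eq_of_size (u := [D]) (w := B p :: dbWord ps) hb
    have h1 : Drawn f (B p :: dbWord ps) (a + wup [D]) (b - wlow [D]) := by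
      simpa [wup, wlow] using hf.2
    have h2 := (h.mono (a' := a + wup [D]) (b' := b - wlow [D])
      (by omega) (by omega)).not_pres_BDB h1 hs
    simpa [wup, wlow, up, low] using h2

/-- The only neighbour of a drawing consisting of DB-elements. -/
lemma Compat.drawn_bdWord {ps : List Bool} (h : Compat f g a b) (hf : Drawn f (dbWord ps) a b)
    (hb : b = a + 2 * wsize (dbWord ps) - 1) : Drawn g (bdWord ps) a b := by
  induction ps generalizing a b with
  | nil => trivial
  | cons p ps ih =>
    have hs := end_eq_of_size (u := [D, B p]) (w := dbWord ps) hb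
    obtain ⟨h1, h2⟩ := (drawn_append f [D, B p] (dbWord ps) a b).1 hf
    have e1 : wup [B p, D] = wup [D, B p] := by cases p <;> rfl
    have e2 : wlow [B p, D] = wlow [D, B p] := by cases p <;> rfl
    have h' := h.mono (a' := a + wup [D, B p]) (b' := b - wlow [D, B p]) (by omega) (by omega)
    refine (drawn_append g [B p, D] (bdWord ps) a b).2
      ⟨h.face_DB (h.pres_dbWord hf hb) (h'.pres_dbWord h2 hs) h1 rfl rfl (by omega), ?_⟩
    rw [e1, e2]
    exact ih h' h2 hs

lemma Compat.drawn_dbWord {ps : List Bool} (h : Compat f g a b) (hf : Drawn f (bdWord ps) a b)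
    (hb : b = a + 2 * wsize (bdWord ps) - 1) (hp : Pres g a b) : Drawn g (dbWord ps) a b := by
  induction ps generalizing a b with
  | nil => trivial
  | cons p ps ih =>
    obtain ⟨h1, h2, h3, h4⟩ := h.step_BD hf hb hp
    exact (drawn_append g [D, B p] (dbWord ps) a b).2
      ⟨h1, ih (h.mono (by omega) (by omega)) h3 h4 h2⟩

/-- This describes what follows a D-edge assigned to the left: all D-edges up to the EDB-element go
left too, so its face keeps only the three B-edges, and behind it the D-edges go right. -/
lemma Compat.drawn_after_cut {ps : List Bool} {s : Bool} {qs : List Bool} (h : Compat f g a b)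
    (hf : Drawn f (bdWord ps ++ B s :: B s :: B (!s) :: dbWord qs) a b)
    (hb : b = a + 2 * wsize (bdWord ps ++ B s :: B s :: B (!s) :: dbWord qs) - 1)
    (hp : Pres g a b) : Drawn g (dbWord ps ++ D :: B s :: D :: bdWord qs) a b := by
  induction ps generalizing a b with
  | nil =>
    have hs := end_eq_of_size (u := [B s, B s, B (!s)]) (w := dbWord qs) hb
    obtain ⟨h1, h2⟩ := (drawn_append f [B s, B s, B (!s)] (dbWord qs) a b).1 hf
    have e1 : wup [D, B s, D] = wup [B s, B s, B (!s)] := by cases s <;> rfl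
    have e2 : wlow [D, B s, D] = wlow [B s, B s, B (!s)] := by cases s <;> rfl
    have h' := h.mono (a' := a + wup [B s, B s, B (!s)]) (b' := b - wlow [B s, B s, B (!s)])
      (by omega) (by omega)
    refine (drawn_append g [D, B s, D] (bdWord qs) a b).2
      ⟨h.face_BBB hp (h'.pres_dbWord h2 hs) h1 rfl rfl (by omega), ?_⟩
    rw [e1, e2]
    exact h'.drawn_bdWord h2 hs
  | cons p ps ih =>
    obtain ⟨h1, h2, h3, h4⟩ := h.step_BD hf hb hp
    exact (drawn_append g [D, B p] _ a b).2
      ⟨h1, ih (h.mono (by omega) (by omega)) h3 h4 h2⟩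

/-- The neighbours of an EDB-matching. -/
lemma Compat.drawn_of_mWord {ps : List Bool} {s : Bool} {qs : List Bool} (h : Compat f g a b)
    (hf : Drawn f (mWord ps s qs) a b) (hb : b = a + 2 * wsize (mWord ps s qs) - 1)
    (hp : Pres g a b) :
    (∃ c, Drawn g (leafWord c ps s qs) a b) ∨
      ∃ ps' s' qs', ps ++ s :: qs = ps' ++ s' :: qs' ∧ ps'.length ≤ ps.length ∧
        Drawn g (nWord ps' s' qs') a b := by
  induction ps generalizing a b with
  | nil =>
    have hs := end_eq_of_size (u := [D, B s, B s, B (!s)]) (w := dbWord qs) hb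
    obtain ⟨h1, h2⟩ := (drawn_append f [D, B s, B s, B (!s)] (dbWord qs) a b).1 hf
    have h' := h.mono (a' := a + wup [D, B s, B s, B (!s)])
      (b' := b - wlow [D, B s, B s, B (!s)]) (by omega) (by omega)
    have h3 := h'.drawn_bdWord h2 hs
    rcases h.face_DBBB hp (h'.pres_dbWord h2 hs) h1 rfl rfl (by omega) with h4 | h4 | h4
    · refine Or.inr ⟨[], s, qs, rfl, le_rfl,
        (drawn_append g [B s, B s, B (!s), D] (bdWord qs) a b).2 ⟨h4, ?_⟩⟩
      cases s <;> exact h3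
    · refine Or.inl ⟨true, (drawn_append g [B s, D, D, D] (bdWord qs) a b).2 ⟨h4, ?_⟩⟩
      cases s <;> exact h3
    · refine Or.inl ⟨false, (drawn_append g [B (!s), D, C s] (bdWord qs) a b).2 ⟨h4, ?_⟩⟩
      cases s <;> exact h3
  | cons p ps ih =>
    have hw : mWord (p :: ps) s qs =
        [D, B p] ++ D :: (bdWord ps ++ B s :: B s :: B (!s) :: dbWord qs) := by
      simp [mWord, dbWord, dbWord_append_D]
    have hw' : mWord (p :: ps) s qs =
        [D, B p, D] ++ (bdWord ps ++ B s :: B s :: B (!s) :: dbWord qs) := hw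
    have hm : mWord ps s qs = D :: (bdWord ps ++ B s :: B s :: B (!s) :: dbWord qs) := by
      simp [mWord, dbWord_append_D]
    rw [← hm] at hw
    have hs := end_eq_of_size (a := a) (b := b) (by rw [← hw]; exact hb)
    have hs' := end_eq_of_size (a := a) (b := b) (by rw [← hw']; exact hb)
    obtain ⟨h1, h2⟩ := (drawn_append f _ _ a b).1 (by rwa [hw] at hf)
    obtain ⟨h1', h2'⟩ := (drawn_append f _ _ a b).1 (by rwa [hw'] at hf)
    have h' := h.mono (a' := a + wup [D, B p]) (b' := b - wlow [D, B p]) (by omega) (by omega)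
    have e1 : wup [B p, D] = wup [D, B p] := by cases p <;> rfl
    have e2 : wlow [B p, D] = wlow [D, B p] := by cases p <;> rfl
    -- The second D-edge decides. If it goes right, the first face has only `D` and `B p`, and
    -- induction applies to the rest; if it goes left, the first face has both D-edges and
    -- everything else is forced.
    rcases h'.side_word (by rwa [hm] at h2) (by rwa [hm] at hs) with hq | hq
    · have h3 := h.face_DB hp hq h1 rfl rfl (by omega)
      rcases ih h' h2 hs hq with ⟨c, h4⟩ | ⟨ps', s', qs', h4, h5, h6⟩
      · refine Or.inl ⟨c, ?_⟩
        have := (drawn_append g [B p, D] _ a b).2 ⟨h3, by rw [e1, e2]; exact h4⟩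
        cases c <;> exact this
      · exact Or.inr ⟨p :: ps', s', qs', by simp [h4], by simpa using h5,
          (drawn_append g [B p, D] _ a b).2 ⟨h3, by rw [e1, e2]; exact h6⟩⟩
    · have hq' : Pres g (a + wup [D, B p, D]) (b - wlow [D, B p, D]) := by
        convert hq using 1 <;> simp [wup, wlow, up, low] <;> ring
      have h3 := h.face_DBD hp hq' h1' rfl rfl (by omega)
      have h4 := (h.mono (by omega) (by omega)).drawn_after_cut h2' hs' hq'
      refine Or.inr ⟨[], p, ps ++ s :: qs, rfl, by simp, ?_⟩
      have hn : nWord [] p (ps ++ s :: qs) =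
          [B p, B p, B !p] ++ (dbWord ps ++ D :: B s :: D :: bdWord qs) := by
        simp [nWord, bdWord, bdWord_append, dbWord_append_D]
      rw [hn, drawn_append]
      refine ⟨h3, ?_⟩
      cases p <;> exact h4

/-- Two consecutive D-edges of a drawing. -/
lemma Compat.face_DD {w : List Piece} (h : Compat f g a b) (hf : Drawn f (D :: D :: w) a b)
    (hb : b = a + 2 * wsize (D :: D :: w) - 1) (hp : Pres g a b) :
    (g a = a + 1 ∧ g (a + 1) = a ∧ g (b - 1) = b ∧ g b = b - 1) ∧ Pres g (a + 2) (b - 2) := by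
  have hs := end_eq_of_size (u := [D]) (w := D :: w) hb
  have h2 : Drawn f (D :: w) (a + wup [D]) (b - wlow [D]) := by simpa [wup, wlow] using hf.2
  have d1 := h.dj a
  have d2 := h.dj (a + 1)
  obtain ⟨⟨f1, f2⟩, ⟨f3, f4⟩, -⟩ := hf
  have h3 := (h.mono (a' := a + wup [D]) (b' := b - wlow [D]) (by omega) (by omega)).side_word h2 hs
  simp [wsize, size, wup, wlow, up, low, add_assoc, sub_sub] at *
  rcases h3 with hq | hq
  -- If the second D-edge went right, the first would be alone in its face.
  · have := h.outer hp hq (x := a) (by omega) (by omega) (by omega)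
    have := h.ne a
    omega
  · refine ⟨h.quad (by omega) (by omega) (by omega) ?_ ?_ (by omega) (by omega), hq⟩
    · have := h.outer hp hq (x := a) (by omega) (by omega) (by omega)
      omega
    · have := h.outer hp hq (x := b) (by omega) (by omega) (by omega)
      omega

lemma Compat.ne_of_swap_eq (h : Compat f g a b) {x y z : ℤ} (hy : g y = z) (hxz : x ≠ z) :
    g x ≠ y := fun he => hxz (by rw [← h.swap he, hy])

/-- The inner edge has no points on its other side, so it must share its face with the outer edge;
otherwise its two ends would be matched to each other. -/
lemma Compat.face_cap (h : Compat f g a b) {x : ℤ} (hx : a ≤ x) (hx' : x + 3 ≤ b)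
    (f0 : f x = x + 3) (f3 : f (x + 3) = x) (f1 : f (x + 1) = x + 2) :
    g x = x + 1 ∧ g (x + 1) = x ∧ g (x + 2) = x + 3 ∧ g (x + 3) = x + 2 := by
  have d0 := h.dj x
  have d1 := h.dj (x + 1)
  rcases h.side hx hx' f0 f3 (by omega) ⟨1, by ring⟩ with hq | hq
  · have q0 := hq x
    have q3 := hq (x + 3)
    exact h.quad (by omega) (by omega) (by omega) (by omega) (by omega) (by omega) (by omega)
  · have q1 := hq (x + 1)
    have := h.ne (x + 1)
    omega

/-- A cap of a drawing. -/
lemma Compat.face_C {s : Bool} {w : List Piece} (h : Compat f g a b)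
    (hf : Drawn f (C s :: w) a b) (hb : b = a + 2 * wsize (C s :: w) - 1) (hp : Pres g a b) :
    Drawn g [B s, B s] a b ∧ Pres g (a + up (C s)) (b - low (C s)) := by
  obtain ⟨hf, -⟩ := hf
  simp only [wsize, size] at hb
  cases s <;> norm_num [DrawnPiece, Drawn, up, low, sub_sub, add_assoc] at hf ⊢
  · have k := h.face_cap (x := b - 3) (by omega) (by omega) (by rw [hf.1.2]; ring)
      (by rw [show b - 3 + 3 = b by ring, hf.1.1])
      (by rw [show b - 3 + 1 = b - 2 by ring, hf.2.2]; ring)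
    rw [show b - 3 + 1 = b - 2 by ring, show b - 3 + 2 = b - 1 by ring,
      show b - 3 + 3 = b by ring] at k
    refine ⟨by omega, fun x hx hx' => ?_⟩
    have q1 := hp x (by omega) (by omega)
    have q2 := h.ne_of_swap_eq k.1 (x := x) (by omega)
    have q3 := h.ne_of_swap_eq k.2.1 (x := x) (by omega)
    have q4 := h.ne_of_swap_eq k.2.2.1 (x := x) (by omega)
    have q5 := h.ne_of_swap_eq k.2.2.2 (x := x) (by omega)
    clear k hf
    omega
  · have k := h.face_cap (x := a) (by omega) (by omega) hf.1.1 hf.1.2 hf.2.1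
    refine ⟨by omega, fun x hx hx' => ?_⟩
    have q1 := hp x (by omega) (by omega)
    have q2 := h.ne_of_swap_eq k.1 (x := x) (by omega)
    have q3 := h.ne_of_swap_eq k.2.1 (x := x) (by omega)
    have q4 := h.ne_of_swap_eq k.2.2.1 (x := x) (by omega)
    have q5 := h.ne_of_swap_eq k.2.2.2 (x := x) (by omega)
    clear k hf
    omega

/-- A leaf has only one neighbour. -/
lemma Compat.drawn_of_leafWord {c : Bool} {ps : List Bool} {s : Bool} {qs : List Bool}
    (h : Compat f g a b) (hf : Drawn f (leafWord c ps s qs) a b)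
    (hb : b = a + 2 * wsize (leafWord c ps s qs) - 1) (hp : Pres g a b) :
    Drawn g (mWord ps s qs) a b := by
  induction ps generalizing a b with
  | nil =>
    cases c
    · obtain ⟨h1, h2, h3, h4⟩ := h.step_BD hf hb hp
      have h' := h.mono (a' := a + wup [D, B !s]) (b' := b - wlow [D, B !s]) (by omega) (by omega)
      obtain ⟨h5, h6⟩ := h'.face_C h3 h4 h2
      have h7 := h3.2
      have h8 := (h'.mono (a' := a + wup [D, B !s] + (C s).up) (b' := b - wlow [D, B !s] - (C s).low)
        (by omega) (by omega)).drawn_dbWord h7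
        (by have := (C s).up_add_low; simp only [wsize] at h4; push_cast at h4; omega) h6
      simp only [mWord, dbWord, List.nil_append]
      -- The result lists the three B-edges in another order than `mWord`; B-edges on opposite sides
      -- may be interchanged without changing the drawing.
      cases s <;> norm_num [Drawn, DrawnPiece, wup, wlow, up, low, sub_sub, add_assoc]
        at h1 h5 h8 ⊢ <;> tauto
    · obtain ⟨h1, h2, h3, h4⟩ := h.step_BD (w := D :: D :: bdWord qs) hf hb hp
      have h' := h.mono (a' := a + wup [D, B s]) (b' := b - wlow [D, B s]) (by omega) (by omega)
      obtain ⟨h5, h6⟩ := h'.face_DD h3 h4 h2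
      have h7 := h3.2.2
      have e1 : (a : ℤ) + wup [D, B s] + D.up + D.up = a + wup [D, B s] + 2 := by
        simp [up]; ring
      have e2 : (b : ℤ) - wlow [D, B s] - D.low - D.low = b - wlow [D, B s] - 2 := by
        simp [low]; ring
      rw [e1, e2] at h7
      have h8 := (h'.mono (a' := a + wup [D, B s] + 2) (b' := b - wlow [D, B s] - 2)
        (by omega) (by omega)).drawn_dbWord h7
        (by simp only [wsize, size] at h4; push_cast at h4; omega) h6
      simp only [mWord, dbWord, List.nil_append]
      cases s <;> norm_num [Drawn, DrawnPiece, wup, wlow, up, low, sub_sub, add_assoc]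
        at h1 h5 h8 ⊢ <;> tauto
  | cons p ps ih =>
    have hw : leafWord c (p :: ps) s qs = B p :: D :: leafWord c ps s qs := by cases c <;> rfl
    rw [hw] at hf hb
    obtain ⟨h1, h2, h3, h4⟩ := h.step_BD hf hb hp
    exact (drawn_append g [D, B p] _ a b).2
      ⟨h1, ih (h.mono (by omega) (by omega)) h3 h4 h2⟩

end

/-! ### Compatibility of explicit drawings -/

/-- `f` and `g` have no common and no crossing edges at the points with property `P`. -/
def NoCrossOn (f g : ℤ → ℤ) (P : ℤ → Prop) : Prop :=
  (∀ x, P x → f x ≠ g x) ∧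
    ∀ x y, P x → P y → ¬ (x < y ∧ y < f x ∧ f x < g y) ∧ ¬ (y < x ∧ x < g y ∧ g y < f x)

lemma NoCrossOn.symm {f g : ℤ → ℤ} {P : ℤ → Prop} (h : NoCrossOn f g P) : NoCrossOn g f P :=
  ⟨fun x hx => (h.1 x hx).symm, fun x y hx hy => (h.2 y x hy hx).symm⟩

lemma NoCrossOn.mono {f g : ℤ → ℤ} {P Q : ℤ → Prop} (h : NoCrossOn f g P)
    (hQ : ∀ x, Q x → P x) : NoCrossOn f g Q :=
  ⟨fun x hx => h.1 x (hQ x hx), fun x y hx hy => h.2 x y (hQ x hx) (hQ y hy)⟩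

section
variable {f g : ℤ → ℤ} {a b a' b' : ℤ}

/-- An edge with one end in the inner interval lies in it entirely, so it cannot alternate with an
edge lying outside this interval. -/
lemma NoCrossOn.extend (hf : Pres f a' b') (hg : Pres g a' b')
    (hfi : ∀ x, f (f x) = x) (hgi : ∀ x, g (g x) = x)
    (hi : NoCrossOn f g fun x => a' ≤ x ∧ x ≤ b')
    (ho : NoCrossOn f g fun x => a ≤ x ∧ x ≤ b ∧ ¬ (a' ≤ x ∧ x ≤ b')) :
    NoCrossOn f g fun x => a ≤ x ∧ x ≤ b := by
  constructor
  · intro x hx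
    by_cases h : a' ≤ x ∧ x ≤ b'
    · exact hi.1 x h
    · exact ho.1 x ⟨hx.1, hx.2, h⟩
  · intro x y hx hy
    by_cases h : a' ≤ x ∧ x ≤ b'
    · by_cases h' : a' ≤ y ∧ y ≤ b'
      · exact hi.2 x y h h'
      · have h1 := hf x h.1 h.2
        have h2 := hg (g y)
        rw [hgi] at h2
        omega
    · by_cases h' : a' ≤ y ∧ y ≤ b'
      · have h1 := hg y h'.1 h'.2
        have h2 := hf (f x)
        rw [hfi] at h2
        omega
      · exact ho.2 x y ⟨hx.1, hx.2, h⟩ ⟨hy.1, hy.2, h'⟩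

/-- Here and in the next lemmas `f` consists of sides of the polygon, which cross no chord; a finite
check over the vertices confirms this. -/
lemma noCross_quad {x₁ x₂ x₃ x₄ : ℤ} (h1 : x₁ < x₂) (h2 : x₂ < x₃) (h3 : x₃ < x₄)
    (f1 : f x₁ = x₄) (f4 : f x₄ = x₁) (f2 : f x₂ = x₃) (f3 : f x₃ = x₂)
    (g1 : g x₁ = x₂) (g2 : g x₂ = x₁) (g3 : g x₃ = x₄) (g4 : g x₄ = x₃) :
    NoCrossOn f g fun x => x = x₁ ∨ x = x₂ ∨ x = x₃ ∨ x = x₄ := by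
  constructor
  · rintro x (rfl | rfl | rfl | rfl) <;> simp only [f1, g1, f2, g2, f3, g3, f4, g4] <;> omega
  · rintro x y (rfl | rfl | rfl | rfl) (rfl | rfl | rfl | rfl) <;> simp only [f1, g1, f2, g2, f3,
      g3, f4, g4] <;> omega

lemma noCross_hexa {x₁ x₂ x₃ x₄ x₅ x₆ : ℤ} (h1 : x₁ < x₂) (h2 : x₂ < x₃) (h3 : x₃ < x₄)
    (h4 : x₄ < x₅) (h5 : x₅ < x₆)
    (f1 : f x₁ = x₆) (f6 : f x₆ = x₁) (f2 : f x₂ = x₃) (f3 : f x₃ = x₂)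
    (f4 : f x₄ = x₅) (f5 : f x₅ = x₄)
    (g1 : g x₁ = x₂) (g2 : g x₂ = x₁) (g3 : g x₃ = x₄) (g4 : g x₄ = x₃)
    (g5 : g x₅ = x₆) (g6 : g x₆ = x₅) :
    NoCrossOn f g fun x => x = x₁ ∨ x = x₂ ∨ x = x₃ ∨ x = x₄ ∨ x = x₅ ∨ x = x₆ := by
  constructor
  · rintro x (rfl | rfl | rfl | rfl | rfl | rfl) <;> simp only [f1, g1, f2, g2, f3, g3, f4, g4,
      f5, g5, f6, g6] <;> omega
  · rintro x y (rfl | rfl | rfl | rfl | rfl | rfl) (rfl | rfl | rfl | rfl | rfl | rfl) <;> simp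
      only [f1, g1, f2, g2, f3, g3, f4, g4, f5, g5, f6, g6] <;> omega

lemma noCross_octa₁ {x₁ x₂ x₃ x₄ x₅ x₆ x₇ x₈ : ℤ} (h1 : x₁ < x₂) (h2 : x₂ < x₃) (h3 : x₃ < x₄)
    (h4 : x₄ < x₅) (h5 : x₅ < x₆) (h6 : x₆ < x₇) (h7 : x₇ < x₈)
    (f1 : f x₁ = x₈) (f8 : f x₈ = x₁) (f2 : f x₂ = x₃) (f3 : f x₃ = x₂)
    (f4 : f x₄ = x₅) (f5 : f x₅ = x₄) (f6 : f x₆ = x₇) (f7 : f x₇ = x₆)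
    (g1 : g x₁ = x₂) (g2 : g x₂ = x₁) (g3 : g x₃ = x₄) (g4 : g x₄ = x₃)
    (g5 : g x₅ = x₆) (g6 : g x₆ = x₅) (g7 : g x₇ = x₈) (g8 : g x₈ = x₇) :
    NoCrossOn f g fun x => x = x₁ ∨ x = x₂ ∨ x = x₃ ∨ x = x₄ ∨ x = x₅ ∨ x = x₆ ∨ x = x₇ ∨ x = x₈
    := by
  constructor
  · rintro x (rfl | rfl | rfl | rfl | rfl | rfl | rfl | rfl) <;> simp only [f1, g1, f2, g2, f3,
      g3, f4, g4, f5, g5, f6, g6, f7, g7, f8, g8] <;> omega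
  · rintro x y (rfl | rfl | rfl | rfl | rfl | rfl | rfl | rfl) (rfl | rfl | rfl | rfl | rfl | rfl
      | rfl | rfl) <;> simp only [f1, g1, f2, g2, f3, g3, f4, g4, f5, g5, f6, g6, f7, g7, f8, g8]
      <;> omega

lemma noCross_octa₂ {x₁ x₂ x₃ x₄ x₅ x₆ x₇ x₈ : ℤ} (h1 : x₁ < x₂) (h2 : x₂ < x₃) (h3 : x₃ < x₄)
    (h4 : x₄ < x₅) (h5 : x₅ < x₆) (h6 : x₆ < x₇) (h7 : x₇ < x₈)
    (f1 : f x₁ = x₈) (f8 : f x₈ = x₁) (f2 : f x₂ = x₃) (f3 : f x₃ = x₂)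
    (f4 : f x₄ = x₅) (f5 : f x₅ = x₄) (f6 : f x₆ = x₇) (f7 : f x₇ = x₆)
    (g1 : g x₁ = x₂) (g2 : g x₂ = x₁) (g3 : g x₃ = x₈) (g8 : g x₈ = x₃)
    (g4 : g x₄ = x₇) (g7 : g x₇ = x₄) (g5 : g x₅ = x₆) (g6 : g x₆ = x₅) :
    NoCrossOn f g fun x => x = x₁ ∨ x = x₂ ∨ x = x₃ ∨ x = x₄ ∨ x = x₅ ∨ x = x₆ ∨ x = x₇ ∨ x = x₈
    := by
  constructor
  · rintro x (rfl | rfl | rfl | rfl | rfl | rfl | rfl | rfl) <;> simp only [f1, g1, f2, g2, f3,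
      g3, f4, g4, f5, g5, f6, g6, f7, g7, f8, g8] <;> omega
  · rintro x y (rfl | rfl | rfl | rfl | rfl | rfl | rfl | rfl) (rfl | rfl | rfl | rfl | rfl | rfl
      | rfl | rfl) <;> simp only [f1, g1, f2, g2, f3, g3, f4, g4, f5, g5, f6, g6, f7, g7, f8, g8]
      <;> omega

lemma noCross_octa₃ {x₁ x₂ x₃ x₄ x₅ x₆ x₇ x₈ : ℤ} (h1 : x₁ < x₂) (h2 : x₂ < x₃) (h3 : x₃ < x₄)
    (h4 : x₄ < x₅) (h5 : x₅ < x₆) (h6 : x₆ < x₇) (h7 : x₇ < x₈)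
    (f1 : f x₁ = x₈) (f8 : f x₈ = x₁) (f2 : f x₂ = x₃) (f3 : f x₃ = x₂)
    (f4 : f x₄ = x₅) (f5 : f x₅ = x₄) (f6 : f x₆ = x₇) (f7 : f x₇ = x₆)
    (g1 : g x₁ = x₆) (g6 : g x₆ = x₁) (g2 : g x₂ = x₅) (g5 : g x₅ = x₂)
    (g3 : g x₃ = x₄) (g4 : g x₄ = x₃) (g7 : g x₇ = x₈) (g8 : g x₈ = x₇) :
    NoCrossOn f g fun x => x = x₁ ∨ x = x₂ ∨ x = x₃ ∨ x = x₄ ∨ x = x₅ ∨ x = x₆ ∨ x = x₇ ∨ x = x₈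
    := by
  constructor
  · rintro x (rfl | rfl | rfl | rfl | rfl | rfl | rfl | rfl) <;> simp only [f1, g1, f2, g2, f3,
      g3, f4, g4, f5, g5, f6, g6, f7, g7, f8, g8] <;> omega
  · rintro x y (rfl | rfl | rfl | rfl | rfl | rfl | rfl | rfl) (rfl | rfl | rfl | rfl | rfl | rfl
      | rfl | rfl) <;> simp only [f1, g1, f2, g2, f3, g3, f4, g4, f5, g5, f6, g6, f7, g7, f8, g8]
      <;> omega

end

/-- Two words that occupy the same points, and whose drawings have no common edges and no
crossings. -/
def FaceCompat (u v : List Piece) : Prop :=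
  wup u = wup v ∧ wlow u = wlow v ∧ ∀ (f g : ℤ → ℤ) (a b : ℤ), a + wup u ≤ b - wlow u + 1 →
    Drawn f u a b → Drawn g v a b →
      NoCrossOn f g fun x => a ≤ x ∧ x ≤ b ∧ ¬ (a + wup u ≤ x ∧ x ≤ b - wlow u)

lemma FaceCompat.symm {u v : List Piece} (h : FaceCompat u v) : FaceCompat v u := by
  obtain ⟨h1, h2, h3⟩ := h
  refine ⟨h1.symm, h2.symm, fun f g a b hab hf hg => ?_⟩
  rw [← h1, ← h2] at hab ⊢
  exact (h3 g f a b hab hg hf).symm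

lemma faceCompat_quad (s : Bool) : FaceCompat [D, B s] [B s, D] := by
  refine ⟨by cases s <;> rfl, by cases s <;> rfl, fun f g a b hab hf hg => ?_⟩
  cases s <;> norm_num [Drawn, DrawnPiece, wup, wlow, up, low, add_assoc, sub_sub] at * <;>
    casesm* _ ∧ _
  · refine (noCross_quad (x₁ := a) (x₂ := b - 2) (x₃ := b - 1) (x₄ := b) ?_ ?_ ?_ ?_ ?_ ?_ ?_
      ?_ ?_ ?_ ?_).mono ?_ <;>
      first | assumption | omega
  · refine (noCross_quad (x₁ := a) (x₂ := a + 1) (x₃ := a + 2) (x₄ := b) ?_ ?_ ?_ ?_ ?_ ?_ ?_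
      ?_ ?_ ?_ ?_).mono ?_ <;>
      first | assumption | omega

lemma faceCompat_hexa (s : Bool) : FaceCompat [D, B s, D] [B s, B s, B !s] := by
  refine ⟨by cases s <;> rfl, by cases s <;> rfl, fun f g a b hab hf hg => ?_⟩
  cases s <;> norm_num [Drawn, DrawnPiece, wup, wlow, up, low, add_assoc, sub_sub] at * <;>
    casesm* _ ∧ _
  · refine (noCross_hexa (x₁ := a) (x₂ := a + 1) (x₃ := b - 3) (x₄ := b - 2) (x₅ := b - 1)
      (x₆ := b) ?_ ?_ ?_ ?_ ?_ ?_ ?_ ?_ ?_ ?_ ?_ ?_ ?_ ?_ ?_ ?_ ?_).mono ?_ <;>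
      first | assumption | omega
  · refine (noCross_hexa (x₁ := a) (x₂ := a + 1) (x₃ := a + 2) (x₄ := a + 3) (x₅ := b - 1)
      (x₆ := b) ?_ ?_ ?_ ?_ ?_ ?_ ?_ ?_ ?_ ?_ ?_ ?_ ?_ ?_ ?_ ?_ ?_).mono ?_ <;>
      first | assumption | omega

set_option maxHeartbeats 1000000 in
lemma faceCompat_octa₁ (s : Bool) :
    FaceCompat [D, B s, B s, B !s] [B s, B s, B !s, D] := by
  refine ⟨by cases s <;> rfl, by cases s <;> rfl, fun f g a b hab hf hg => ?_⟩
  cases s <;> norm_num [Drawn, DrawnPiece, wup, wlow, up, low, add_assoc, sub_sub] at * <;>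
    casesm* _ ∧ _
  · refine (noCross_octa₁ (x₁ := a) (x₂ := a + 1) (x₃ := a + 2) (x₄ := b - 4) (x₅ := b - 3)
      (x₆ := b - 2) (x₇ := b - 1) (x₈ := b) ?_ ?_ ?_ ?_ ?_ ?_ ?_ ?_ ?_ ?_ ?_ ?_ ?_ ?_ ?_ ?_ ?_
      ?_ ?_ ?_ ?_ ?_ ?_).mono ?_ <;>
      first | assumption | omega
  · refine (noCross_octa₁ (x₁ := a) (x₂ := a + 1) (x₃ := a + 2) (x₄ := a + 3) (x₅ := a + 4)
      (x₆ := b - 2) (x₇ := b - 1) (x₈ := b) ?_ ?_ ?_ ?_ ?_ ?_ ?_ ?_ ?_ ?_ ?_ ?_ ?_ ?_ ?_ ?_ ?_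
      ?_ ?_ ?_ ?_ ?_ ?_).mono ?_ <;>
      first | assumption | omega

set_option maxHeartbeats 1000000 in
lemma faceCompat_octa₂ (s : Bool) :
    FaceCompat [D, B s, B s, B !s] [B s, D, D, D] := by
  refine ⟨by cases s <;> rfl, by cases s <;> rfl, fun f g a b hab hf hg => ?_⟩
  cases s <;> norm_num [Drawn, DrawnPiece, wup, wlow, up, low, add_assoc, sub_sub] at * <;>
    casesm* _ ∧ _
  · refine (noCross_octa₃ (x₁ := a) (x₂ := a + 1) (x₃ := a + 2) (x₄ := b - 4) (x₅ := b - 3)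
      (x₆ := b - 2) (x₇ := b - 1) (x₈ := b) ?_ ?_ ?_ ?_ ?_ ?_ ?_ ?_ ?_ ?_ ?_ ?_ ?_ ?_ ?_ ?_ ?_
      ?_ ?_ ?_ ?_ ?_ ?_).mono ?_ <;>
      first | assumption | omega
  · refine (noCross_octa₂ (x₁ := a) (x₂ := a + 1) (x₃ := a + 2) (x₄ := a + 3) (x₅ := a + 4)
      (x₆ := b - 2) (x₇ := b - 1) (x₈ := b) ?_ ?_ ?_ ?_ ?_ ?_ ?_ ?_ ?_ ?_ ?_ ?_ ?_ ?_ ?_ ?_ ?_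
      ?_ ?_ ?_ ?_ ?_ ?_).mono ?_ <;>
      first | assumption | omega

set_option maxHeartbeats 1000000 in
lemma faceCompat_octa₃ (s : Bool) :
    FaceCompat [D, B s, B s, B !s] [B !s, D, C s] := by
  refine ⟨by cases s <;> rfl, by cases s <;> rfl, fun f g a b hab hf hg => ?_⟩
  cases s <;> norm_num [Drawn, DrawnPiece, wup, wlow, up, low, add_assoc, sub_sub] at * <;>
    casesm* _ ∧ _
  · refine (noCross_octa₂ (x₁ := a) (x₂ := a + 1) (x₃ := a + 2) (x₄ := b - 4) (x₅ := b - 3)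
      (x₆ := b - 2) (x₇ := b - 1) (x₈ := b) ?_ ?_ ?_ ?_ ?_ ?_ ?_ ?_ ?_ ?_ ?_ ?_ ?_ ?_ ?_ ?_ ?_
      ?_ ?_ ?_ ?_ ?_ ?_).mono ?_ <;>
      first | assumption | omega
  · refine (noCross_octa₃ (x₁ := a) (x₂ := a + 1) (x₃ := a + 2) (x₄ := a + 3) (x₅ := a + 4)
      (x₆ := b - 2) (x₇ := b - 1) (x₈ := b) ?_ ?_ ?_ ?_ ?_ ?_ ?_ ?_ ?_ ?_ ?_ ?_ ?_ ?_ ?_ ?_ ?_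
      ?_ ?_ ?_ ?_ ?_ ?_).mono ?_ <;>
      first | assumption | omega

/-- Words that are composed of compatible pieces. -/
inductive WordCompat : List Piece → List Piece → Prop
  | nil : WordCompat [] []
  | append {u v w w' : List Piece} : FaceCompat u v → WordCompat w w' →
      WordCompat (u ++ w) (v ++ w')

lemma WordCompat.wsize_eq {u v : List Piece} (h : WordCompat u v) : wsize u = wsize v := by
  induction h with
  | nil => rfl
  | @append u v w w' h1 _ ih =>
    have h2 := h1.1
    have h3 := h1.2.1
    have h4 := wup_add_wlow u
    have h5 := wup_add_wlow v
    rw [wsize_append, wsize_append]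
    omega

lemma WordCompat.symm {u v : List Piece} (h : WordCompat u v) : WordCompat v u := by
  induction h with
  | nil => exact .nil
  | append h1 _ ih => exact .append h1.symm ih

lemma WordCompat.noCrossOn {u v : List Piece} (h : WordCompat u v) {f g : ℤ → ℤ} {a b : ℤ}
    (hfi : ∀ x, f (f x) = x) (hgi : ∀ x, g (g x) = x) (hf : Drawn f u a b) (hg : Drawn g v a b)
    (hb : b = a + 2 * wsize u - 1) : NoCrossOn f g fun x => a ≤ x ∧ x ≤ b := by
  induction h generalizing a b with
  | nil =>
    simp only [wsize] at hb
    exact ⟨fun x hx => by omega, fun x y hx hy => by omega⟩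
  | @append u v w w' h1 h2 ih =>
    rw [drawn_append] at hf hg
    have hs := end_eq_of_size hb
    rw [← h1.1, ← h1.2.1] at hg
    have hs' := hs
    rw [h2.wsize_eq] at hs'
    exact NoCrossOn.extend (hf.2.pres hs) (hg.2.pres hs') hfi hgi (ih hf.2 hg.2 hs)
      (h1.2.2 f g a b (by omega) hf.1 hg.1)

lemma wordCompat_db_bd (ps : List Bool) {w w' : List Piece} (h : WordCompat w w') :
    WordCompat (dbWord ps ++ w) (bdWord ps ++ w') := by
  induction ps with
  | nil => exact h
  | cons p ps ih => exact .append (u := [D, B p]) (v := [B p, D]) (faceCompat_quad p) ih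

lemma wordCompat_dbWord (ps : List Bool) : WordCompat (dbWord ps) (bdWord ps) := by
  simpa using wordCompat_db_bd ps .nil

lemma wordCompat_leafWord (c : Bool) (ps : List Bool) (s : Bool) (qs : List Bool) :
    WordCompat (mWord ps s qs) (leafWord c ps s qs) := by
  cases c
  · exact wordCompat_db_bd ps (.append (faceCompat_octa₃ s) (wordCompat_dbWord qs))
  · exact wordCompat_db_bd ps (.append (faceCompat_octa₂ s) (wordCompat_dbWord qs))

lemma wordCompat_nWord {ps ps' : List Bool} {s s' : Bool} {qs qs' : List Bool}
    (h : ps ++ s :: qs = ps' ++ s' :: qs') (hl : ps'.length ≤ ps.length) :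
    WordCompat (mWord ps s qs) (nWord ps' s' qs') := by
  induction ps' generalizing ps with
  | nil =>
    cases ps with
    | nil =>
      simp only [List.nil_append, List.cons.injEq] at h
      obtain ⟨rfl, rfl⟩ := h
      exact .append (u := [D, B s, B s, B !s]) (v := [B s, B s, B !s, D]) (faceCompat_octa₁ s)
        (wordCompat_dbWord qs)
    | cons p ps =>
      simp only [List.nil_append, List.cons_append, List.cons.injEq] at h
      obtain ⟨rfl, rfl⟩ := h
      have h1 : mWord (p :: ps) s qs =
          [D, B p, D] ++ (bdWord ps ++ ([B s, B s, B !s] ++ dbWord qs)) := by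
        simp [mWord, dbWord, dbWord_append_D]
      have h2 : nWord [] p (ps ++ s :: qs) =
          [B p, B p, B !p] ++ (dbWord ps ++ ([D, B s, D] ++ bdWord qs)) := by
        simp [nWord, bdWord, bdWord_append, dbWord_append_D]
      rw [h1, h2]
      -- Between the two EDB-elements the roles are exchanged: there the first drawing reads `B`,
      -- `D` and the second `D`, `B`. Hence the symmetric form.
      refine .append (faceCompat_hexa p) (WordCompat.symm (wordCompat_db_bd ps ?_))
      exact .append (faceCompat_hexa s) (wordCompat_dbWord qs).symm
  | cons p ps' ih =>
    cases ps with
    | nil => simp at hl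
    | cons q ps =>
      simp only [List.cons_append, List.cons.injEq] at h
      obtain ⟨rfl, h⟩ := h
      exact .append (u := [D, B q]) (v := [B q, D]) (faceCompat_quad q)
        (ih h (by simpa using hl))

/-! ### EDB-matchings -/

/-- The number of `true` minus the number of `false` in a list. -/
def sgnSum (ps : List Bool) : ℤ := (ps.map fun b => if b then (1 : ℤ) else -1).sum

lemma sgnSum_append (ps qs : List Bool) : sgnSum (ps ++ qs) = sgnSum ps + sgnSum qs := by
  simp [sgnSum]

lemma sgnSum_cons (s : Bool) (qs : List Bool) :
    sgnSum (s :: qs) = (if s then 1 else -1) + sgnSum qs := by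
  simp [sgnSum]

lemma signSum_eq {m : ℕ} (p : Fin m → Bool) : signSum p = sgnSum (List.ofFn p) := by
  rw [sgnSum, List.map_ofFn, List.sum_ofFn, signSum]
  rfl

lemma signSum_revNeg {m : ℕ} (p : Fin m → Bool) : signSum (revNeg p) = -signSum p := by
  rw [signSum, signSum, ← Finset.sum_neg_distrib]
  refine Fintype.sum_equiv Fin.revPerm _ _ fun i => ?_
  simp only [revNeg, Fin.revPerm_apply]
  by_cases h : p i.rev = true <;> simp [h]

lemma revNeg_revNeg {m : ℕ} (p : Fin m → Bool) : revNeg (revNeg p) = p := by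
  funext i
  simp [revNeg]

/-- Since the passage to `p'` and `z'` is an involution, results about the vertices with `p` and `z`
also apply to those with `p'` and `z'`. -/
lemma zPrime_zPrime {l : ℕ} (p : Fin (l - 1) → Bool) (z : ZMod (2 * (2 * l))) :
    zPrime (revNeg p) (zPrime p z) = z := by
  have h : ((2 * (2 * l) : ℕ) : ZMod (2 * (2 * l))) = 0 := ZMod.natCast_self _
  simp only [zPrime, signSum_revNeg]
  push_cast at h ⊢
  linear_combination h

lemma wup_dbWord (ps : List Bool) : (wup (dbWord ps) : ℤ) = 2 * ps.length + sgnSum ps := by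
  induction ps with
  | nil => simp [dbWord, wup, sgnSum]
  | cons s ps ih =>
    rw [sgnSum_cons]
    cases s <;> simp [dbWord, wup, up, ih] <;> ring

/-- The upper side has `k + δ(p)` points. So `z + k + δ(p)` is the label of the rightmost lower
point, which is where the formula for `z'` comes from. -/
lemma wup_mWord (ps : List Bool) (s : Bool) (qs : List Bool) :
    (wup (mWord ps s qs) : ℤ) =
      2 * (ps ++ s :: qs).length + 2 + sgnSum (ps ++ s :: qs) := by
  rw [sgnSum_append, sgnSum_cons, mWord, wup_append]
  push_cast
  rw [wup_dbWord]
  simp only [wup]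
  push_cast
  rw [wup_dbWord]
  cases s <;> simp [up] <;> ring

/-- A list reversed, with all signs changed. -/
def negReverse (ps : List Bool) : List Bool := (ps.map not).reverse

lemma dbWord_append (ps qs : List Bool) : dbWord (ps ++ qs) = dbWord ps ++ dbWord qs := by
  induction ps with
  | nil => rfl
  | cons p ps ih => simp [dbWord, ih]

lemma wrot_dbWord (ps : List Bool) : wrot (dbWord (negReverse ps)) = bdWord ps := by
  induction ps with
  | nil => rfl
  | cons p ps ih =>
    rw [negReverse] at ih
    simp [negReverse, dbWord_append, wrot_append, ih, dbWord, bdWord, wrot, Piece.rot]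

/-- The half-turn yields the B-edges of the EDB-element in another order, which matters only for
B-edges on the same side. -/
lemma drawn_nWord_of_rot {R : Type*} [CommRing R] {g : R → R} {t b : R} {ps : List Bool}
    {s : Bool} {qs : List Bool}
    (h : Drawn g (wrot (mWord (negReverse qs) (!s) (negReverse ps))) t b) :
    Drawn g (nWord ps s qs) t b := by
  have h1 : wrot (mWord (negReverse qs) (!s) (negReverse ps)) =
      bdWord ps ++ ([B !s, B s, B s, D] ++ bdWord qs) := by
    simp [mWord, wrot_append, wrot_dbWord, wrot, Piece.rot]
  have h2 : nWord ps s qs = bdWord ps ++ ([B s, B s, B !s, D] ++ bdWord qs) := by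
    simp [nWord]
  rw [h1, drawn_append, drawn_append] at h
  rw [h2, drawn_append, drawn_append]
  refine ⟨h.1, ?_, ?_⟩
  · have h3 := h.2.1
    generalize t + ↑(wup (bdWord ps)) = t at h3 ⊢
    generalize b - ↑(wlow (bdWord ps)) = b at h3 ⊢
    cases s <;> simp [Drawn, DrawnPiece, up, low] at h3 ⊢ <;> tauto
  · have h3 := h.2.2
    cases s <;> exact h3

lemma edbDrawing_toPiece {l : ℕ} (p : Fin (l - 1) → Bool) (j : Fin (l - 1)) :
    (edbDrawing p j).map StripEdge.toPiece =
      mWord ((List.ofFn p).take j) (p j) ((List.ofFn p).drop (j + 1)) := by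
  have h : List.ofFn (edbElement p j) =
      ((List.ofFn p).take j).map (fun s => [StripEdge.D, .B s]) ++
        [StripEdge.D, .B (p j), .B (p j), .B (!p j)] ::
          ((List.ofFn p).drop (j + 1)).map (fun s => [StripEdge.D, .B s]) := by
    apply List.ext_getElem
    · simp; omega
    · intro i h1 h2
      simp only [List.length_ofFn] at h1
      rw [List.getElem_ofFn, List.getElem_append]
      simp only [edbElement, List.length_map, List.length_take, List.length_ofFn]
      rcases lt_trichotomy i j.val with hi | hi | hi
      · rw [if_neg (by rw [Fin.ext_iff]; simp; omega), dif_pos (by omega)]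
        simp
      · subst hi
        rw [if_pos (by simp), dif_neg (by omega), List.getElem_cons]
        simp
      · rw [if_neg (by rw [Fin.ext_iff]; simp; omega), dif_neg (by omega), List.getElem_cons,
          dif_neg (by omega)]
        simp
        congr 3
        omega
  have hdb : ∀ ps : List Bool, (ps.map fun s => [StripEdge.D, .B s]).flatten.map
      StripEdge.toPiece = dbWord ps := by
    intro ps
    induction ps with
    | nil => rfl
    | cons s ps ih => simp only [List.map_cons, List.flatten_cons, List.map_append, ih]; rfl
  rw [edbDrawing, h, List.flatten_append, List.flatten_cons, List.map_append, List.map_append,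
    hdb, hdb]
  rfl

lemma drawn_edb {l : ℕ} (j : Fin (l - 1)) (p : Fin (l - 1) → Bool) (z : ZMod (2 * (2 * l))) :
    Drawn (edb j p z).partner
      (mWord ((List.ofFn p).take j) (p j) ((List.ofFn p).drop (j + 1))) z (z - 1) := by
  rw [← edbDrawing_toPiece]
  exact drawn_stripMatching _ _ _ z

lemma ofFn_eq {l : ℕ} (j : Fin (l - 1)) (p : Fin (l - 1) → Bool) :
    (List.ofFn p).take j ++ p j :: (List.ofFn p).drop (j + 1) = List.ofFn p := by
  have h : (List.ofFn p)[j.val]'(by simp) = p j := by simp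
  rw [← h, List.cons_getElem_drop_succ, List.take_append_drop]

lemma ofFn_revNeg {m : ℕ} (p : Fin m → Bool) :
    List.ofFn (revNeg p) = negReverse (List.ofFn p) := by
  apply List.ext_getElem
  · simp [negReverse]
  · intro i h1 h2
    simp [negReverse, revNeg]
    congr 1
    ext
    simp; omega

/-- The half-turn of an EDB-matching, drawn with the same leftmost upper point. -/
lemma drawn_edb_rev {l : ℕ} (i : Fin (l - 1)) (p : Fin (l - 1) → Bool)
    (z : ZMod (2 * (2 * l))) :
    Drawn (edb i.rev (revNeg p) (zPrime p z)).partner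
      (nWord ((List.ofFn p).take i) (p i) ((List.ofFn p).drop (i + 1))) z (z - 1) := by
  have h := (drawn_edb i.rev (revNeg p) (zPrime p z)).rot
  have hl := i.isLt
  have e1 : (List.ofFn (revNeg p)).take i.rev = negReverse ((List.ofFn p).drop (i + 1)) := by
    rw [ofFn_revNeg, negReverse, negReverse, List.take_reverse, List.map_drop]
    congr 2
    simp; omega
  have e2 : (List.ofFn (revNeg p)).drop (i.rev + 1) = negReverse ((List.ofFn p).take i) := by
    rw [ofFn_revNeg, negReverse, negReverse, List.drop_reverse, List.map_take]
    congr 2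
    simp; omega
  have e3 : revNeg p i.rev = !p i := by simp [revNeg]
  have hw := wup_mWord ((List.ofFn (revNeg p)).take i.rev) (revNeg p i.rev)
    ((List.ofFn (revNeg p)).drop (i.rev + 1))
  have hz := wsize_mWord ((List.ofFn (revNeg p)).take i.rev) (revNeg p i.rev)
    ((List.ofFn (revNeg p)).drop (i.rev + 1))
  have hwl := wup_add_wlow (mWord ((List.ofFn (revNeg p)).take i.rev) (revNeg p i.rev)
    ((List.ofFn (revNeg p)).drop (i.rev + 1)))
  rw [ofFn_eq] at hw hz
  rw [← signSum_eq, signSum_revNeg, List.length_ofFn] at hw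
  rw [List.length_ofFn] at hz
  rw [e1, e2, e3] at h hw hz hwl
  apply drawn_nWord_of_rot
  set W := mWord (negReverse ((List.ofFn p).drop (i + 1))) (!p i)
    (negReverse ((List.ofFn p).take i))
  have hn : ((2 * (2 * l) : ℕ) : ZMod (2 * (2 * l))) = 0 := ZMod.natCast_self _
  have hw' : (wup W : ℤ) = 2 * l - signSum p := by omega
  have hwl' : (wlow W : ℤ) = 2 * l + signSum p := by omega
  have c1 : ((wup W : ℕ) : ZMod (2 * (2 * l))) = ((2 * l - signSum p : ℤ) : ZMod _) := by
    rw [← hw', Int.cast_natCast]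
  have c2 : ((wlow W : ℕ) : ZMod (2 * (2 * l))) = ((2 * l + signSum p : ℤ) : ZMod _) := by
    rw [← hwl', Int.cast_natCast]
  rw [c1, c2] at h
  -- After the half-turn the first upper point is `z' - wlow W`, which is `z`, and the first lower
  -- point is `z' + wup W - 1`, which is `z - 1` because `2k = 0`.
  convert h using 1
  · simp only [zPrime]
    push_cast
    ring
  · simp only [zPrime]
    push_cast at hn ⊢
    linear_combination -hn

/-! ### Neighbours in the disjoint compatibility graph -/

lemma WordCompat.adj {k : ℕ} {M N : NCMatching k} {z : ZMod (2 * k)} {u v : List Piece}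
    (h : WordCompat u v) (hk : k ≠ 0) (hu : wsize u = k) (hM : Drawn M.partner u z (z - 1))
    (hN : Drawn N.partner v z (z - 1)) : (DCM k).Adj M N := by
  have hv : wsize v = k := h.wsize_eq ▸ hu
  rw [adj_iff_disjCompat, disjCompat_iff hk M N z]
  have h1 := h.noCrossOn (off_off M z) (off_off N z) ((drawn_off_iff M z hu).2 hM)
    ((drawn_off_iff N z hv).2 hN) (by rw [hu]; ring)
  exact ⟨fun x hx hx' => h1.1 x ⟨hx, hx'⟩,
    fun x y hx hx' hy hy' => h1.2 x y ⟨hx, hx'⟩ ⟨hy, hy'⟩⟩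

section
variable {k : ℕ} {M N : NCMatching k} {z : ZMod (2 * k)} {ps : List Bool} {s : Bool}
  {qs : List Bool}

lemma drawn_of_adj_mWord (hk : 2 * (ps ++ s :: qs).length + 2 = k)
    (hM : Drawn M.partner (mWord ps s qs) z (z - 1)) (h : (DCM k).Adj M N) :
    (∃ c, Drawn N.partner (leafWord c ps s qs) z (z - 1)) ∨
      ∃ ps' s' qs', ps ++ s :: qs = ps' ++ s' :: qs' ∧ ps'.length ≤ ps.length ∧
        Drawn N.partner (nWord ps' s' qs') z (z - 1) := by
  have hM' := (drawn_off_iff M z ((wsize_mWord ps s qs).trans hk)).2 hM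
  rcases (h.2.compat (by omega) z).drawn_of_mWord hM' (by rw [wsize_mWord, hk]; ring)
    (pres_off N z) with ⟨c, h1⟩ | ⟨ps', s', qs', h1, h2, h3⟩
  · exact Or.inl ⟨c, (drawn_off_iff N z ((wsize_leafWord c ps s qs).trans hk)).1 h1⟩
  · refine Or.inr ⟨ps', s', qs', h1, h2, (drawn_off_iff N z ?_).1 h3⟩
    rw [wsize_nWord, ← h1, hk]

lemma drawn_of_adj_leafWord {c : Bool} (hk : 2 * (ps ++ s :: qs).length + 2 = k)
    (hM : Drawn M.partner (leafWord c ps s qs) z (z - 1)) (h : (DCM k).Adj M N) :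
    Drawn N.partner (mWord ps s qs) z (z - 1) := by
  have hM' := (drawn_off_iff M z ((wsize_leafWord c ps s qs).trans hk)).2 hM
  exact (drawn_off_iff N z ((wsize_mWord ps s qs).trans hk)).1
    ((h.2.compat (by omega) z).drawn_of_leafWord hM' (by rw [wsize_leafWord, hk]; ring)
      (pres_off N z))

end

/-- The bound on the length matters: on an interval of only two points both pieces draw the same
edge. -/
lemma not_drawn_B_of_drawn_D {f : ℤ → ℤ} {a b : ℤ} {s : Bool} {u v : List Piece}
    (hab : a + 3 ≤ b) (hD : Drawn f (D :: u) a b) (hB : Drawn f (B s :: v) a b) : False := by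
  obtain ⟨⟨h1, h2⟩, -⟩ := hD
  obtain ⟨h3, -⟩ := hB
  cases s <;> simp only [DrawnPiece] at h3 <;> omega

/-- Behind the `D` and `B` of an element comes a B-edge if it is the EDB-element, and a D-edge if it
is an earlier one. So the drawing reveals its place. -/
lemma length_eq_of_drawn_mWord {f : ℤ → ℤ} {a b : ℤ} {ps ps' : List Bool} {s s' : Bool}
    {qs qs' : List Bool} (he : ps ++ s :: qs = ps' ++ s' :: qs')
    (hb : b = a + 2 * wsize (mWord ps s qs) - 1) (h : Drawn f (mWord ps s qs) a b)
    (h' : Drawn f (mWord ps' s' qs') a b) : ps.length = ps'.length := by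
  induction ps generalizing ps' a b with
  | nil =>
    cases ps' with
    | nil => rfl
    | cons p ps' =>
      exfalso
      obtain ⟨w, hw⟩ : ∃ w, mWord ps' s' qs' = D :: w :=
        ⟨_, by rw [mWord, dbWord_append_D]⟩
      have hw' : mWord (p :: ps') s' qs' = [D, B p] ++ D :: w := by
        rw [← hw]; rfl
      simp only [List.nil_append, List.cons_append, List.cons.injEq] at he
      obtain ⟨rfl, -⟩ := he
      have e : mWord [] s qs = [D, B s] ++ B s :: B (!s) :: dbWord qs := rfl
      rw [hw', drawn_append] at h'
      rw [e] at hb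
      have hs := end_eq_of_size hb
      rw [e, drawn_append] at h
      refine not_drawn_B_of_drawn_D ?_ h'.2 h.2
      simp only [wsize, size] at hs
      omega
  | cons q ps ih =>
    cases ps' with
    | nil =>
      exfalso
      obtain ⟨w, hw⟩ : ∃ w, mWord ps s qs = D :: w :=
        ⟨_, by rw [mWord, dbWord_append_D]⟩
      have e : mWord (q :: ps) s qs = [D, B q] ++ mWord ps s qs := rfl
      simp only [List.nil_append, List.cons_append, List.cons.injEq] at he
      obtain ⟨rfl, -⟩ := he
      have e' : mWord [] q qs' = [D, B q] ++ B q :: B (!q) :: dbWord qs' := rfl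
      rw [e', drawn_append] at h'
      rw [e] at hb
      have hs := end_eq_of_size hb
      rw [e, drawn_append, hw] at h
      refine not_drawn_B_of_drawn_D ?_ h.2 h'.2
      rw [wsize_mWord] at hs
      simp only [List.length_append, List.length_cons] at hs
      omega
    | cons q' ps' =>
      simp only [List.cons_append, List.cons.injEq] at he
      obtain ⟨rfl, he⟩ := he
      have e : mWord (q :: ps) s qs = [D, B q] ++ mWord ps s qs := rfl
      have e' : mWord (q :: ps') s' qs' = [D, B q] ++ mWord ps' s' qs' := rfl
      rw [e] at hb h
      rw [e', drawn_append] at h'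
      rw [drawn_append] at h
      simpa using ih he (end_eq_of_size hb) h.2 h'.2

lemma not_drawn_leafWord {f : ℤ → ℤ} {a b : ℤ} {ps : List Bool} {s : Bool} {qs : List Bool}
    (hb : b = a + 2 * wsize (leafWord true ps s qs) - 1)
    (h : Drawn f (leafWord true ps s qs) a b) (h' : Drawn f (leafWord false ps s qs) a b) :
    False := by
  rw [wsize_leafWord] at hb
  simp only [leafWord, drawn_append] at h h'
  have hs := wup_add_wlow (bdWord ps)
  rw [wsize_bdWord] at hs
  simp only [List.length_append, List.length_cons] at hb
  obtain ⟨-, h1, h2, -⟩ := h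
  obtain ⟨-, k1, k2, -⟩ := h'
  cases s <;> simp [DrawnPiece, up, low] at h1 h2 k1 k2 <;> omega

/-- The two leaves at an EDB-matching. -/
lemma exists_leaf {l : ℕ} (c : Bool) (j : Fin (l - 1)) (p : Fin (l - 1) → Bool)
    (z : ZMod (2 * (2 * l))) : ∃ N : NCMatching (2 * l), Drawn N.partner
      (leafWord c ((List.ofFn p).take j) (p j) ((List.ofFn p).drop (j + 1))) z (z - 1) := by
  have := j.isLt
  refine exists_drawn (by omega) z ?_
  rw [wsize_leafWord, ofFn_eq, List.length_ofFn]
  omega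

/-- The leaf of index `c` at an EDB-matching. -/
noncomputable def edbLeaf {l : ℕ} (c : Bool) (j : Fin (l - 1)) (p : Fin (l - 1) → Bool)
    (z : ZMod (2 * (2 * l))) : NCMatching (2 * l) :=
  (exists_leaf c j p z).choose

section
variable {l : ℕ} (j : Fin (l - 1)) (p : Fin (l - 1) → Bool) (z : ZMod (2 * (2 * l)))

lemma drawn_edbLeaf (c : Bool) : Drawn (edbLeaf c j p z).partner
    (leafWord c ((List.ofFn p).take j) (p j) ((List.ofFn p).drop (j + 1))) z (z - 1) :=
  (exists_leaf c j p z).choose_spec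

lemma edb_size : 2 * ((List.ofFn p).take j ++ p j :: (List.ofFn p).drop (j + 1)).length + 2 =
    2 * l := by
  have := j.isLt
  rw [ofFn_eq, List.length_ofFn]
  omega

lemma edb_adj_edb {i : Fin (l - 1)}
    (h : l ≤ j.val + 1 + (i.val + 1)) :
    (DCM (2 * l)).Adj (edb j p z) (edb i (revNeg p) (zPrime p z)) := by
  -- Seen from the left, the second matching has its EDB-element at `i.rev`, and the hypothesis says
  -- that this is at most `j`.
  have hN := drawn_edb_rev i.rev p z
  rw [Fin.rev_rev] at hN
  have := j.isLt
  refine (wordCompat_nWord ?_ ?_).adj (by omega) ((wsize_mWord _ _ _).trans (edb_size j p))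
    (drawn_edb j p z) hN
  · rw [ofFn_eq, ofFn_eq]
  · simp
    omega

lemma edb_adj_edbLeaf (c : Bool) : (DCM (2 * l)).Adj (edb j p z) (edbLeaf c j p z) := by
  have := j.isLt
  exact (wordCompat_leafWord c _ _ _).adj (by omega) ((wsize_mWord _ _ _).trans (edb_size j p))
    (drawn_edb j p z) (drawn_edbLeaf j p z c)

lemma eq_of_edbLeaf_adj {c : Bool} {N : NCMatching (2 * l)}
    (h : (DCM (2 * l)).Adj (edbLeaf c j p z) N) : N = edb j p z := by
  have := j.isLt
  exact eq_of_drawn (by omega) ((wsize_mWord _ _ _).trans (edb_size j p))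
    (drawn_of_adj_leafWord (edb_size j p) (drawn_edbLeaf j p z c) h) (drawn_edb j p z)

lemma eq_of_edb_adj {N : NCMatching (2 * l)} (h : (DCM (2 * l)).Adj (edb j p z) N) :
    (∃ c, N = edbLeaf c j p z) ∨
      ∃ i : Fin (l - 1), l ≤ j.val + 1 + (i.val + 1) ∧ N = edb i (revNeg p) (zPrime p z) := by
  have hl := j.isLt
  rcases drawn_of_adj_mWord (edb_size j p) (drawn_edb j p z) h with
    ⟨c, h1⟩ | ⟨ps, s, qs, h1, h2, h3⟩
  · exact Or.inl ⟨c, eq_of_drawn (by omega) ((wsize_leafWord _ _ _ _).trans (edb_size j p)) h1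
      (drawn_edbLeaf j p z c)⟩
  · right
    rw [List.length_take, List.length_ofFn] at h2
    let i : Fin (l - 1) := ⟨ps.length, by omega⟩
    refine ⟨i.rev, by rw [Fin.val_rev]; simp only [i]; omega, ?_⟩
    have h4 := drawn_edb_rev i p z
    rw [ofFn_eq] at h1
    have h5 := ofFn_eq i p
    rw [h1] at h5
    obtain ⟨e1, e2⟩ := List.append_inj h5 (by simp [i])
    rw [List.cons.injEq] at e2
    rw [← h1] at e1 e2
    rw [e1, e2.1, e2.2] at h4
    refine eq_of_drawn (by omega) ?_ h3 h4
    rw [wsize_nWord, ← h1, List.length_ofFn]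
    omega

lemma edb_injective : Function.Injective fun j : Fin (l - 1) => edb j p z := by
  intro i j h
  have hl := i.isLt
  have h1 := (drawn_off_iff _ z ((wsize_mWord _ _ _).trans (edb_size i p))).2 (drawn_edb i p z)
  have h2 := (drawn_off_iff _ z ((wsize_mWord _ _ _).trans (edb_size j p))).2 (drawn_edb j p z)
  simp only at h
  rw [← h] at h2
  have h3 := length_eq_of_drawn_mWord (by rw [ofFn_eq, ofFn_eq])
    (by rw [wsize_mWord, edb_size]; ring) h1 h2
  ext
  simp at h3
  omega

/-- Drawn from the same leftmost point, one matching begins with a D-edge and the other with a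
B-edge. -/
lemma edb_ne_edb_rev (i : Fin (l - 1)) : edb j p z ≠ edb i (revNeg p) (zPrime p z) := by
  intro h
  have hl := i.isLt
  have h1 := (drawn_off_iff _ z ((wsize_mWord _ _ _).trans (edb_size j p))).2 (drawn_edb j p z)
  have h2 := (drawn_off_iff _ z ((wsize_nWord _ _ _).trans (edb_size i.rev p))).2
    (drawn_edb_rev i.rev p z)
  rw [Fin.rev_rev, ← h] at h2
  rw [mWord, dbWord_append_D] at h1
  obtain ⟨s, w, hw⟩ : ∃ s w, nWord ((List.ofFn p).take i.rev) (p i.rev)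
      ((List.ofFn p).drop (i.rev + 1)) = B s :: w := by
    cases (List.ofFn p).take i.rev with
    | nil => exact ⟨_, _, rfl⟩
    | cons s ps => exact ⟨_, _, rfl⟩
  rw [hw] at h2
  exact not_drawn_B_of_drawn_D (by push_cast; omega) h1 h2

lemma edbLeaf_ne : edbLeaf true j p z ≠ edbLeaf false j p z := by
  intro h
  have h1 := (drawn_off_iff _ z ((wsize_leafWord _ _ _ _).trans (edb_size j p))).2
    (drawn_edbLeaf j p z true)
  have h2 := (drawn_off_iff _ z ((wsize_leafWord _ _ _ _).trans (edb_size j p))).2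
    (drawn_edbLeaf j p z false)
  rw [← h] at h2
  exact not_drawn_leafWord (by rw [wsize_leafWord, edb_size]; ring) h1 h2

end

/-! ### Paths with additional edges and two leaves at every vertex -/

/-- The vertices `v t` span a graph with adjacency relation `R`, which contains the path
`v 0, v 1, …`; the other neighbours of `v t` are two leaves. -/
structure IsPathWithLeaves {V : Type*} (G : SimpleGraph V) {n : ℕ} (R : Fin n → Fin n → Prop)
    (v : Fin n → V) (leaf : Fin n → Bool → V) : Prop where
  inj : Function.Injective v
  adj_iff : ∀ s t, G.Adj (v s) (v t) ↔ R s t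
  path : ∀ s t, s.val + 1 = t.val → R s t
  leaf_ne : ∀ t, leaf t true ≠ leaf t false
  adj_leaf : ∀ t c, G.Adj (v t) (leaf t c)
  eq_of_leaf_adj : ∀ t c x, G.Adj (leaf t c) x → x = v t
  mem_of_adj : ∀ t x, G.Adj (v t) x → x ∈ Set.range v ∨ ∃ c, x = leaf t c

namespace IsPathWithLeaves

variable {V : Type*} {G : SimpleGraph V} {n : ℕ} {R : Fin n → Fin n → Prop}
  {v : Fin n → V} {leaf : Fin n → Bool → V}

/-- A vertex of the path has two different leaves as neighbours, whereas a leaf has only one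
neighbour. -/
lemma leaf_not_mem (h : IsPathWithLeaves G R v leaf) (t : Fin n) (c : Bool) :
    leaf t c ∉ Set.range v := by
  rintro ⟨s, hs⟩
  have h1 := h.adj_leaf s
  rw [hs] at h1
  exact h.leaf_ne s
    ((h.eq_of_leaf_adj t c _ (h1 true)).trans (h.eq_of_leaf_adj t c _ (h1 false)).symm)

lemma outer_neighbors (h : IsPathWithLeaves G R v leaf) (t : Fin n) :
    {x | G.Adj (v t) x ∧ x ∉ Set.range v} = {leaf t true, leaf t false} := by
  ext x
  simp only [Set.mem_ofPred_eq, Set.mem_insert_iff, Set.mem_singleton_iff]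
  constructor
  · rintro ⟨h1, h2⟩
    obtain ⟨c, rfl⟩ := (h.mem_of_adj t x h1).resolve_left h2
    cases c <;> simp
  · rintro (rfl | rfl)
    exacts [⟨h.adj_leaf t true, h.leaf_not_mem t true⟩, ⟨h.adj_leaf t false, h.leaf_not_mem t false⟩]

lemma neighborSet_leaf (h : IsPathWithLeaves G R v leaf) (t : Fin n) (c : Bool) :
    G.neighborSet (leaf t c) = {v t} := by
  ext x
  rw [SimpleGraph.mem_neighborSet, Set.mem_singleton_iff]
  exact ⟨h.eq_of_leaf_adj t c x, fun hx => hx ▸ (h.adj_leaf t c).symm⟩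

/-- The vertices of a path with leaves. -/
def vertex (v : Fin n → V) (leaf : Fin n → Bool → V) : Fin n × Option Bool → V
  | (t, none) => v t
  | (t, some c) => leaf t c

lemma vertex_injective (h : IsPathWithLeaves G R v leaf) :
    Function.Injective (vertex v leaf) := by
  rintro ⟨s, _ | c⟩ ⟨t, _ | d⟩ he <;> simp only [vertex] at he
  · rw [h.inj he]
  · exact absurd ⟨s, he⟩ (h.leaf_not_mem t d)
  · exact absurd ⟨t, he.symm⟩ (h.leaf_not_mem s c)
  · have h1 := h.adj_leaf s c
    rw [he] at h1
    obtain rfl := h.inj (h.eq_of_leaf_adj t d _ h1.symm)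
    have h2 := h.leaf_ne s
    cases c <;> cases d <;> first | rfl | exact absurd he h2 | exact absurd he.symm h2

/-- The right-hand side involves only indices, so `R` determines the component up to isomorphism. -/
lemma adj_vertex_iff (h : IsPathWithLeaves G R v leaf) (x y : Fin n × Option Bool) :
    G.Adj (vertex v leaf x) (vertex v leaf y) ↔
      (x.2 = none ∧ y.2 = none ∧ R x.1 y.1) ∨
        (x.1 = y.1 ∧ (x.2 = none ∧ y.2 ≠ none ∨ x.2 ≠ none ∧ y.2 = none)) := by
  obtain ⟨s, _ | c⟩ := x <;> obtain ⟨t, _ | d⟩ := y <;> simp [vertex]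
  · exact h.adj_iff s t
  · exact ⟨fun h1 => h.inj (h.eq_of_leaf_adj t d _ h1.symm), fun h1 => h1 ▸ h.adj_leaf s d⟩
  · exact ⟨fun h1 => (h.inj (h.eq_of_leaf_adj s c _ h1)).symm, fun h1 => h1 ▸ (h.adj_leaf s c).symm⟩
  · intro h1
    exact h.leaf_not_mem t d ⟨s, (h.eq_of_leaf_adj s c _ h1).symm⟩

lemma range_vertex (h : IsPathWithLeaves G R v leaf) (t₀ : Fin n) :
    Set.range (vertex v leaf) = (G.connectedComponentMk (v t₀)).supp := by
  have hn : 0 < n := t₀.pos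
  have hp : ∀ m (hm : m < n), G.Reachable (v ⟨0, hn⟩) (v ⟨m, hm⟩) := by
    intro m
    induction m with
    | zero => exact fun _ => .rfl
    | succ m ih =>
      exact fun hm => (ih (by omega)).trans
        ((h.adj_iff _ _).2 (h.path ⟨m, by omega⟩ ⟨m + 1, hm⟩ rfl)).reachable
  ext x
  rw [SimpleGraph.ConnectedComponent.mem_supp_iff, SimpleGraph.ConnectedComponent.eq]
  constructor
  · rintro ⟨⟨t, c⟩, rfl⟩
    have h1 : G.Reachable (v t) (v t₀) := (hp t t.isLt).symm.trans (hp t₀ t₀.isLt)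
    cases c with
    | none => exact h1
    | some c => exact (h.adj_leaf t c).symm.reachable.trans h1
  · rintro ⟨p⟩
    -- The set of path vertices and leaves is closed under adjacency, hence no walk leaves it.
    have : ∀ (x y : V), G.Walk x y → y ∈ Set.range (vertex v leaf) →
        x ∈ Set.range (vertex v leaf) := by
      intro x y p
      induction p with
      | nil => exact id
      | cons hadj _ ih =>
        intro hy
        obtain ⟨⟨t, c⟩, hw⟩ := ih hy
        rw [← hw] at hadj
        cases c with
        | none =>
          rcases h.mem_of_adj t _ hadj.symm with ⟨s, hs⟩ | ⟨c, hc⟩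
          · exact ⟨(s, none), hs⟩
          · exact ⟨(t, some c), hc.symm⟩
        | some c => exact ⟨(t, none), (h.eq_of_leaf_adj t c _ hadj.symm).symm⟩
    exact this _ _ p ⟨(t₀, none), rfl⟩

lemma supp_eq (h : IsPathWithLeaves G R v leaf) (t₀ : Fin n) :
    (G.connectedComponentMk (v t₀)).supp = Set.range v ∪ {x | ∃ t, G.Adj (v t) x} := by
  rw [← h.range_vertex t₀]
  ext x
  constructor
  · rintro ⟨⟨t, _ | c⟩, rfl⟩
    · exact Or.inl ⟨t, rfl⟩
    · exact Or.inr ⟨t, h.adj_leaf t c⟩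
  · rintro (⟨t, rfl⟩ | ⟨t, ht⟩)
    · exact ⟨(t, none), rfl⟩
    · rcases h.mem_of_adj t _ ht with ⟨s, rfl⟩ | ⟨c, rfl⟩
      exacts [⟨(s, none), rfl⟩, ⟨(t, some c), rfl⟩]

lemma ncard_supp (h : IsPathWithLeaves G R v leaf) (t₀ : Fin n) :
    (G.connectedComponentMk (v t₀)).supp.ncard = 3 * n := by
  rw [← h.range_vertex t₀, ← Set.image_univ, Set.ncard_image_of_injective _ h.vertex_injective,
    Set.ncard_univ, Nat.card_eq_fintype_card]
  simp [mul_comm]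

lemma nonempty_iso_component (h : IsPathWithLeaves G R v leaf) (t₀ : Fin n) :
    Nonempty (G.comap (vertex v leaf) ≃g (G.connectedComponentMk (v t₀)).toSimpleGraph) := by
  exact ⟨⟨(Equiv.ofInjective _ h.vertex_injective).trans (Equiv.setCongr (h.range_vertex t₀)),
    Iff.rfl⟩⟩

lemma nonempty_iso {V' : Type*} {G' : SimpleGraph V'} {v' : Fin n → V'}
    {leaf' : Fin n → Bool → V'} (h : IsPathWithLeaves G R v leaf)
    (h' : IsPathWithLeaves G' R v' leaf') (t t' : Fin n) :
    Nonempty ((G.connectedComponentMk (v t)).toSimpleGraph ≃g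
      (G'.connectedComponentMk (v' t')).toSimpleGraph) := by
  have he : G.comap (vertex v leaf) = G'.comap (vertex v' leaf') := by
    ext x y
    rw [SimpleGraph.comap_adj, SimpleGraph.comap_adj, h.adj_vertex_iff, h'.adj_vertex_iff]
  obtain ⟨e⟩ := h.nonempty_iso_component t
  obtain ⟨e'⟩ := h'.nonempty_iso_component t'
  rw [← he] at e'
  exact ⟨e.symm.trans e'⟩

end IsPathWithLeaves

/-! ### The component of an EDB-matching -/

section
variable {l : ℕ} (p : Fin (l - 1) → Bool) (z : ZMod (2 * (2 * l)))

/-- Adjacency of the vertices of the path, in terms of their indices. -/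
def PathAdj (n : ℕ) (s t : Fin n) : Prop :=
  (s.val % 2 = 0 ∧ t.val % 2 = 1 ∧ t.val / 2 ≤ s.val / 2) ∨
    (s.val % 2 = 1 ∧ t.val % 2 = 0 ∧ s.val / 2 ≤ t.val / 2)

lemma edb_ne_edbLeaf (i j : Fin (l - 1)) (p' : Fin (l - 1) → Bool) (z' : ZMod (2 * (2 * l)))
    (c : Bool) : edb i p z ≠ edbLeaf c j p' z' := by
  intro h
  have h1 := edb_adj_edbLeaf i p z
  rw [h] at h1
  exact edbLeaf_ne i p z
    ((eq_of_edbLeaf_adj j p' z' (h1 true)).trans (eq_of_edbLeaf_adj j p' z' (h1 false)).symm)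

/-- All neighbours of `edb i p z` are leaves or belong to `p'` and `z'`, and `edb j p z` is neither.
-/
lemma edb_not_adj (i j : Fin (l - 1)) : ¬ (DCM (2 * l)).Adj (edb i p z) (edb j p z) := by
  intro h
  rcases eq_of_edb_adj i p z h with ⟨c, hc⟩ | ⟨m, -, hm⟩
  · exact edb_ne_edbLeaf p z j i p z c hc
  · exact edb_ne_edb_rev j p z m hm

lemma edb_adj_iff (i j : Fin (l - 1)) :
    (DCM (2 * l)).Adj (edb i p z) (edb j (revNeg p) (zPrime p z)) ↔
      l ≤ i.val + 1 + (j.val + 1) := by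
  refine ⟨fun h => ?_, edb_adj_edb i p z⟩
  rcases eq_of_edb_adj i p z h with ⟨c, hc⟩ | ⟨m, hm, he⟩
  · exact absurd hc (edb_ne_edbLeaf _ _ j i p z c)
  · rwa [edb_injective _ _ he]

/-- The index of the EDB-element of a vertex of the path. -/
def pathIndex (t : Fin (2 * l - 2)) : Fin (l - 1) :=
  ⟨t.val / 2, by have := t.isLt; omega⟩

lemma pathVertex_even {t : Fin (2 * l - 2)} (h : t.val % 2 = 0) :
    pathVertex p z t = edb (pathIndex t) p z := if_pos h

lemma pathVertex_odd {t : Fin (2 * l - 2)} (h : t.val % 2 = 1) :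
    pathVertex p z t = edb (pathIndex t).rev (revNeg p) (zPrime p z) := if_neg (by omega)

/-- The leaves at the vertices of the path. -/
noncomputable def pathLeaf (t : Fin (2 * l - 2)) (c : Bool) : NCMatching (2 * l) :=
  if t.val % 2 = 0 then edbLeaf c (pathIndex t) p z
  else edbLeaf c (pathIndex t).rev (revNeg p) (zPrime p z)

lemma pathLeaf_even {t : Fin (2 * l - 2)} (h : t.val % 2 = 0) (c : Bool) :
    pathLeaf p z t c = edbLeaf c (pathIndex t) p z := if_pos h

lemma pathLeaf_odd {t : Fin (2 * l - 2)} (h : t.val % 2 = 1) (c : Bool) :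
    pathLeaf p z t c = edbLeaf c (pathIndex t).rev (revNeg p) (zPrime p z) := if_neg (by omega)

lemma edb_mem_range (i : Fin (l - 1)) : edb i p z ∈ Set.range (pathVertex p z) := by
  refine ⟨⟨2 * i.val, by omega⟩, ?_⟩
  rw [pathVertex_even p z (by simp)]
  congr 1
  ext
  simp [pathIndex]

lemma edb_rev_mem_range (i : Fin (l - 1)) :
    edb i (revNeg p) (zPrime p z) ∈ Set.range (pathVertex p z) := by
  refine ⟨⟨2 * i.rev.val + 1, by omega⟩, ?_⟩
  rw [pathVertex_odd p z (by simp)]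
  congr 1
  rw [Fin.rev_eq_iff]
  ext
  simp only [pathIndex]
  omega

lemma pathIndex_eq {s t : Fin (2 * l - 2)} (h : pathIndex s = pathIndex t)
    (h' : s.val % 2 = t.val % 2) : s = t := by
  have h1 := congrArg Fin.val h
  simp only [pathIndex] at h1
  ext
  omega

lemma pathVertex_injective : Function.Injective (pathVertex p z) := by
  intro s t h
  rcases Nat.mod_two_eq_zero_or_one s.val with hs | hs <;>
    rcases Nat.mod_two_eq_zero_or_one t.val with ht | ht
  · rw [pathVertex_even p z hs, pathVertex_even p z ht] at h
    exact pathIndex_eq (edb_injective _ _ h) (hs.trans ht.symm)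
  · rw [pathVertex_even p z hs, pathVertex_odd p z ht] at h
    exact absurd h (edb_ne_edb_rev _ p z _)
  · rw [pathVertex_odd p z hs, pathVertex_even p z ht] at h
    exact absurd h.symm (edb_ne_edb_rev _ p z _)
  · rw [pathVertex_odd p z hs, pathVertex_odd p z ht] at h
    exact pathIndex_eq (Fin.rev_injective (edb_injective _ _ h)) (hs.trans ht.symm)

lemma pathVertex_adj_iff (s t : Fin (2 * l - 2)) :
    (DCM (2 * l)).Adj (pathVertex p z s) (pathVertex p z t) ↔ PathAdj (2 * l - 2) s t := by
  have hs' := s.isLt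
  have ht' := t.isLt
  rcases Nat.mod_two_eq_zero_or_one s.val with hs | hs <;>
    rcases Nat.mod_two_eq_zero_or_one t.val with ht | ht
  · rw [pathVertex_even p z hs, pathVertex_even p z ht]
    refine iff_of_false (edb_not_adj p z _ _) ?_
    simp only [PathAdj]
    omega
  · rw [pathVertex_even p z hs, pathVertex_odd p z ht, edb_adj_iff, Fin.val_rev]
    simp only [PathAdj, pathIndex]
    omega
  · rw [pathVertex_odd p z hs, pathVertex_even p z ht, SimpleGraph.adj_comm, edb_adj_iff,
      Fin.val_rev]
    simp only [PathAdj, pathIndex]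
    omega
  · rw [pathVertex_odd p z hs, pathVertex_odd p z ht]
    refine iff_of_false (edb_not_adj _ _ _ _) ?_
    simp only [PathAdj]
    omega

lemma isPathWithLeaves :
    IsPathWithLeaves (DCM (2 * l)) (PathAdj (2 * l - 2)) (pathVertex p z) (pathLeaf p z) where
  inj := pathVertex_injective p z
  adj_iff := pathVertex_adj_iff p z
  path s t h := by simp only [PathAdj]; omega
  leaf_ne t := by
    rcases Nat.mod_two_eq_zero_or_one t.val with ht | ht
    · simp only [pathLeaf_even p z ht]
      exact edbLeaf_ne _ _ _
    · simp only [pathLeaf_odd p z ht]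
      exact edbLeaf_ne _ _ _
  adj_leaf t c := by
    rcases Nat.mod_two_eq_zero_or_one t.val with ht | ht
    · rw [pathLeaf_even p z ht, pathVertex_even p z ht]
      exact edb_adj_edbLeaf _ _ _ c
    · rw [pathLeaf_odd p z ht, pathVertex_odd p z ht]
      exact edb_adj_edbLeaf _ _ _ c
  eq_of_leaf_adj t c x h := by
    rcases Nat.mod_two_eq_zero_or_one t.val with ht | ht
    · rw [pathLeaf_even p z ht] at h
      rw [pathVertex_even p z ht]
      exact eq_of_edbLeaf_adj _ _ _ h
    · rw [pathLeaf_odd p z ht] at h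
      rw [pathVertex_odd p z ht]
      exact eq_of_edbLeaf_adj _ _ _ h
  mem_of_adj t x h := by
    rcases Nat.mod_two_eq_zero_or_one t.val with ht | ht
    · simp only [pathLeaf_even p z ht]
      rw [pathVertex_even p z ht] at h
      rcases eq_of_edb_adj _ _ _ h with hc | ⟨i, -, rfl⟩
      exacts [Or.inr hc, Or.inl (edb_rev_mem_range p z i)]
    · simp only [pathLeaf_odd p z ht]
      rw [pathVertex_odd p z ht] at h
      rcases eq_of_edb_adj _ _ _ h with hc | ⟨i, -, rfl⟩
      · exact Or.inr hc
      · rw [revNeg_revNeg, zPrime_zPrime]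
        exact Or.inl (edb_mem_range p z i)

end

end DisjointCompatible

open DisjointCompatible in
theorem mainTheorem10 (l : ℕ) (j : Fin (l - 1)) (p : Fin (l - 1) → Bool)
    (z : ZMod (2 * (2 * l))) :
    -- the vertices of the path are pairwise distinct
    Function.Injective (pathVertex p z) ∧
    -- the edges among them are the edges of the path, and the edges `M_a M_b` for which
    -- `a` is even, `b` is odd and `a ≤ b - 3` (here `a = s + 1` and `b = t + 1`)
    (∀ s t : Fin (2 * l - 2), s < t →
      ((DCM (2 * l)).Adj (pathVertex p z s) (pathVertex p z t) ↔
        s.val + 1 = t.val ∨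
          (Even (s.val + 1) ∧ Odd (t.val + 1) ∧ (s.val + 1) + 3 ≤ t.val + 1))) ∧
    -- in terms of the parameters, the edges of the path are those with `j₁ + j₂ ∈ {l, l + 1}`
    -- and the additional edges are those with `j₁ + j₂ ≥ l + 2`
    (∀ i₁ i₂ : Fin (l - 1),
      (DCM (2 * l)).Adj (edb i₁ p z) (edb i₂ (revNeg p) (zPrime p z)) ↔
        ((i₁.val + 1) + (i₂.val + 1) = l ∨ (i₁.val + 1) + (i₂.val + 1) = l + 1) ∨
          l + 2 ≤ (i₁.val + 1) + (i₂.val + 1)) ∧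
    -- every vertex of the path has exactly two neighbours outside the path, both of them leaves
    (∀ t : Fin (2 * l - 2),
      {N | (DCM (2 * l)).Adj (pathVertex p z t) N ∧ N ∉ Set.range (pathVertex p z)}.ncard = 2 ∧
      ∀ N, (DCM (2 * l)).Adj (pathVertex p z t) N → N ∉ Set.range (pathVertex p z) →
        (DCM (2 * l)).neighborSet N = {pathVertex p z t}) ∧
    -- the component consists of the vertices of the path and of these leaves
    ((DCM (2 * l)).connectedComponentMk (edb j p z)).supp =
      Set.range (pathVertex p z) ∪ {N | ∃ t, (DCM (2 * l)).Adj (pathVertex p z t) N} ∧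
    -- its order is `3 (k - 2)`
    ((DCM (2 * l)).connectedComponentMk (edb j p z)).supp.ncard = 3 * (2 * l - 2) ∧
    -- any two components that contain EDB-matchings of size `k` are isomorphic
    (∀ (j₂ : Fin (l - 1)) (p₂ : Fin (l - 1) → Bool) (z₂ : ZMod (2 * (2 * l))),
      Nonempty (((DCM (2 * l)).connectedComponentMk (edb j p z)).toSimpleGraph ≃g
        ((DCM (2 * l)).connectedComponentMk (edb j₂ p₂ z₂)).toSimpleGraph)) := by
  have h := isPathWithLeaves p z
  obtain ⟨t, ht⟩ := edb_mem_range p z j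
  rw [← ht]
  refine ⟨h.inj, fun s t hst => ?_, fun i₁ i₂ => ?_, fun t => ⟨?_, fun N hN hN' => ?_⟩,
    h.supp_eq t, h.ncard_supp t, fun j₂ p₂ z₂ => ?_⟩
  · rw [h.adj_iff]
    simp only [PathAdj, Nat.even_iff, Nat.odd_iff]
    rw [Fin.lt_def] at hst
    omega
  · rw [edb_adj_iff]
    omega
  · rw [h.outer_neighbors]
    exact Set.ncard_pair (h.leaf_ne t)
  · obtain ⟨c, rfl⟩ := (h.mem_of_adj t N hN).resolve_left hN'
    exact h.neighborSet_leaf t c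
  · obtain ⟨t₂, ht₂⟩ := edb_mem_range p₂ z₂ j₂
    rw [← ht₂]
    -- Both components are described by the same relation `PathAdj` on the same index set.
    exact h.nonempty_iso (isPathWithLeaves p₂ z₂) t t₂
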